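/- **Setting.** Let $G$ be a connected $k$-regular simple graph on $n$ vertices, $k\ge 2$; its vertices are the bins. Let $c>0$ be real and $L=\lfloor c\log n\rfloor$ ($\log$ is the natural logarithm). *Walkers.* Two walkers start, at time $0$, on two independent uniformly random directed edges; a walker on the directed edge $(j,i)$ stands at the vertex $i$ (so the two starting vertices are independent and uniform). Let $W_1(t),W_2(t)$ be the vertices at which they stand at time $t$. At each time $t\ge1$ each walker, independently, proposes a non-backtracking step: from $(j,i)$ to $(i,w)$ with $w$ uniform on the $k-1$ neighbours of $i$ other than $j$ (realised through an arbitrary fixed enumeration of these neighbours by $k-1$ labels and an independent uniform label). If at least one of the proposed vertices has been visited by one of the two walkers since the last restart (time $0$ counts as a restart here, and the positions at the restart itself count as visited), or if the last restart took place at time $t-L$, then neither step is made, and a *restart* occurs at time $t$: both walkers are put on fresh independent uniformly random directed edges, and the record of visited vertices is erased. Otherwise both walkers make the proposed steps. All labels and restart edges are uniform and mutually independent. Let $T_1$ be the time of the first restart after time $0$. *Allocation.* All bins are empty at time $0$. At each time $t=0,1,\dots,n-1$ one ball is put into the less loaded one of the bins $W_1(t),W_2(t)$; ties are broken by an arbitrary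 deterministic rule, which may depend on the whole history of the walkers up to and including time $t$. **Theorem.** There is an absolute constant $K$ such that for every $\alpha\in(0,1)$ and every $\varepsilon>0$ there is an $n_0$ for which the following holds. Let $n\ge n_0$, let $c$ satisfy $c\log n\ge 1$ and $c\le n^{1-\alpha}$ (which, for a fixed constant $c>0$, is true for all large $n$), let $k\ge2$, let $G$ be a connected $k$-regular simple graph on $n$ vertices, and fix any enumeration of the possible non-backtracking steps and any tie-breaking rule as above. If $$\Pr\bigl(T_1<\lfloor c\log n\rfloor\bigr)\le 0.1, \tag{N}$$ then $$\Pr\bigl(\text{the maximum load after the } n \text{ balls is at most } \log_2\log n+K\bigr)\ \ge\ 1-\varepsilon .$$ In other words, under (N) the maximum load is at most $\log_2\log n+O(1)$ with high probability as $n\to\infty$, uniformly in the graph, the degree and the tie-breaking rule. -/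

import Mathlib

open MeasureTheory ProbabilityTheory

/-- Directed edges of a graph carry the discrete sigma-algebra. -/
instance SimpleGraph.Dart.instMeasurableSpaceTop {V : Type*} (G : SimpleGraph V) :
    MeasurableSpace G.Dart := ⊤

/-- For every directed edge `e = (j, i)`, an enumeration by `k - 1` labels of the set
`N(i) \ {j}` of vertices to which a non-backtracking walker that has just traversed `e`
may move. -/
abbrev NBLabelling {V : Type*} (G : SimpleGraph V) (k : ℕ) : Type _ :=
  (e : G.Dart) → Fin (k - 1) ≃ {w : V // G.Adj e.snd w ∧ w ≠ e.fst}

/-- The non-backtracking step with label `l` from the directed edge `e = (j, i)`: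
the directed edge `(i, w)`, where `w` is the element of `N(i) \ {j}` with label `l`. -/
def NBLabelling.step {V : Type*} {G : SimpleGraph V} {k : ℕ} (T : NBLabelling G k)
    (e : G.Dart) (l : Fin (k - 1)) : G.Dart :=
  ⟨(e.snd, (T e l).1), (T e l).2.1⟩

/-- The state of the two walkers: the directed edges they traversed last (each walker stands
at the second vertex of its edge), the set of vertices visited by either walker since
the last restart, and the number of steps since the last restart. -/
structure WalkState {V : Type*} (G : SimpleGraph V) where
  edge : Fin 2 → G.Dart
  visited : Set V
  clock : ℕ

/-- The vertex at which walker `j` stands. -/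
def WalkState.pos {V : Type*} {G : SimpleGraph V} (s : WalkState G) (j : Fin 2) : V :=
  (s.edge j).snd

/-- The state right after the walkers have been put on the directed edges `r 0`, `r 1`. -/
def WalkState.fresh {V : Type*} {G : SimpleGraph V} (r : Fin 2 → G.Dart) : WalkState G where
  edge := r
  visited := {v | ∃ j, v = (r j).snd}
  clock := 0

/-- From state `s`, with proposed labels `d 0`, `d 1`, a restart happens: one of the walkers
would arrive at a vertex visited since the last restart, or the restart is due because
`L` time steps have passed. -/
def WalkState.Restarts {V : Type*} {G : SimpleGraph V} {k : ℕ} (T : NBLabelling G k) (L : ℕ)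
    (s : WalkState G) (d : Fin 2 → Fin (k - 1)) : Prop :=
  (∃ j, (T.step (s.edge j) (d j)).snd ∈ s.visited) ∨ s.clock + 1 = L

open Classical in
/-- One time step of the two walkers, with labels `d` and restart edges `r`. -/
noncomputable def WalkState.next {V : Type*} {G : SimpleGraph V} {k : ℕ}
    (T : NBLabelling G k) (L : ℕ) (s : WalkState G) (d : Fin 2 → Fin (k - 1))
    (r : Fin 2 → G.Dart) : WalkState G :=
  if s.Restarts T L d then WalkState.fresh r
  else
    { edge := fun j => T.step (s.edge j) (d j)
      visited := s.visited ∪ {v | ∃ j, v = (T.step (s.edge j) (d j)).snd}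
      clock := s.clock + 1 }

/-- The trajectory of the two walkers. `(u j t).1` is the label proposed to walker `j` for its
step to time `t` (not used at `t = 0`) and `(u j t).2` is the directed edge on
which walker `j` is put if there is a restart at time `t` (or if `t = 0`). -/
noncomputable def walkers {V : Type*} {G : SimpleGraph V} {k : ℕ} (T : NBLabelling G k) (L : ℕ)
    (u : Fin 2 → ℕ → Fin (k - 1) × G.Dart) : ℕ → WalkState G
  | 0 => WalkState.fresh fun j => (u j 0).2
  | t + 1 => (walkers T L u t).next T L (fun j => (u j (t + 1)).1) (fun j => (u j (t + 1)).2)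

/-- The time of the first restart, `⊤` if there is none. -/
noncomputable def firstRestart {V : Type*} {G : SimpleGraph V} {k : ℕ} (T : NBLabelling G k)
    (L : ℕ) (u : Fin 2 → ℕ → Fin (k - 1) × G.Dart) : ℕ∞ :=
  ⨅ (t : ℕ) (_ : (walkers T L u t).Restarts T L (fun j => (u j (t + 1)).1)), ((t + 1 : ℕ) : ℕ∞)

/-- A deterministic tie-breaking rule: it may depend on the whole history of the walkers up to
the present time `t` (hence on all present and past loads), and it returns the
walker whose bin receives the ball. -/
abbrev TieRule {V : Type*} (G : SimpleGraph V) : Type _ :=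
  (t : ℕ) → (Fin (t + 1) → WalkState G) → Fin 2

/-- The bin that receives the ball inserted at time `t`, when the loads are `q`: the less loaded
one of the bins at which the two walkers stand, ties being broken by `τ`. -/
def chosenBin {V : Type*} {G : SimpleGraph V} (τ : TieRule G) (w : ℕ → WalkState G)
    (q : V → ℕ) (t : ℕ) : V :=
  if q ((w t).pos 0) < q ((w t).pos 1) then (w t).pos 0
  else if q ((w t).pos 1) < q ((w t).pos 0) then (w t).pos 1
  else (w t).pos (τ t fun s => w s)

/-- The vector of loads at time `t`, that is, after the insertions at times `0, …, t - 1`. -/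
def loads {V : Type*} [DecidableEq V] {G : SimpleGraph V} (τ : TieRule G)
    (w : ℕ → WalkState G) : ℕ → V → ℕ
  | 0 => 0
  | t + 1 => loads τ w t + Pi.single (chosenBin τ w (loads τ w t) t) 1

/-- The maximum load at time `t`. -/
def maxLoad {V : Type*} [Fintype V] [DecidableEq V] {G : SimpleGraph V} (τ : TieRule G)
    (w : ℕ → WalkState G) (t : ℕ) : ℕ :=
  Finset.univ.sup (loads τ w t)

/-- The random input of the scheme: the pairs `U j t = (D_j(t), R_j(t))`, for `j` one of the two
walkers and `t` a time, are i.i.d. and uniform on pairs (label, directed edge).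
Equivalently, all labels `D_j(t)` and all restart edges `R_j(t)` are uniform and
mutually independent. -/
structure IsUniformInput {Ω V : Type*} [MeasurableSpace Ω] (P : Measure Ω) {G : SimpleGraph V}
    {k : ℕ} (U : Fin 2 → ℕ → Ω → Fin (k - 1) × G.Dart) : Prop where
  measurable : ∀ j t, Measurable (U j t)
  uniform : ∀ j t x, P {ω | U j t ω = x} = (Nat.card (Fin (k - 1) × G.Dart) : ENNReal)⁻¹
  indep : iIndepFun (fun p : Fin 2 × ℕ => U p.1 p.2) P

-- Call the stretch between consecutive restarts an epoch. No vertex is visited twice within an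
-- epoch, so each bin, when a walker reaches it, still has the load it had at the last restart
-- (`loads_pos`). Hence a ball falls on a bin of load at least `i` only if both walkers stand in the
-- level set frozen at that restart: a double hit. Double hits bound the number of bins of load at
-- least `i + 1` (`card_levelSet_succ_le`).
--
-- The non-backtracking step preserves the uniform law on directed edges, so up to the first restart
-- the walkers are dominated by a uniform pair (`seqExpect_edge_le`). If the frozen set has at most
-- `x * n` bins, an epoch has on average at most `L * x ^ 2` double hits, while by (N) it lasts `L`
-- steps with probability at least 0.9. Therefore (hits − `a` · length) / `L`, with `a = 5 * x ^ 2`,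
-- has exponential moment at most 1, and the exponential of its sum over epochs is a supermartingale
-- (`seqExpect_exp_walkPotential_le`). Consequently the next level set has size at most `10 * x ^ 2
-- * n + b * L` up to an extra failure probability `exp (-b)` (`levelTail_succ_le_add_exp`), and at
-- most `D * 10 * x ^ 2 * n` up to `1 / D` (`levelTail_succ_le_add_inv`).
--
-- Level 40 has at most `n / 40` bins by counting, and from there the fraction is essentially
-- squared in each layer. The exponential bound serves until the fraction is a negative power of
-- `n`; below that `b * L` would dominate, and the Markov bound serves for a number of layers
-- depending only on `α`, until less than one bin remains (`exists_layer`).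

-- Averages over finite sequences of independent uniform terms.

/-- The sequence that starts with `b` and continues with `ζ`. -/
def seqCons {B : Type*} (b : B) (ζ : ℕ → B) : ℕ → B
  | 0 => b
  | t + 1 => ζ t

/-- The first `j` terms of `η`, followed by `ζ`. -/
def seqAppend {B : Type*} (j : ℕ) (η ζ : ℕ → B) : ℕ → B :=
  fun t => if t < j then η t else ζ (t - j)

lemma seqAppend_zero {B : Type*} (η ζ : ℕ → B) : seqAppend 0 η ζ = ζ := by
  funext t
  simp [seqAppend]

lemma seqAppend_succ {B : Type*} (j : ℕ) (b : B) (η ζ : ℕ → B) :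
    seqAppend (j + 1) (seqCons b η) ζ = seqCons b (seqAppend j η ζ) := by
  funext t
  cases t <;> simp [seqAppend, seqCons]

lemma update_seqCons_zero {B : Type*} (b c : B) (ζ : ℕ → B) :
    Function.update (seqCons b ζ) 0 c = seqCons c ζ := by
  funext t
  cases t <;> simp [seqCons]

lemma update_seqCons_succ {B : Type*} (s : ℕ) (b c : B) (ζ : ℕ → B) :
    Function.update (seqCons b ζ) (s + 1) c = seqCons b (Function.update ζ s c) := by
  funext t
  cases t <;> simp [seqCons, Function.update_apply]

/-- The expectation of `f` when the first `N` terms of the argument are independent and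
uniform (and the others have a default value). -/
noncomputable def seqExpect {B : Type*} [Fintype B] [Inhabited B] :
    ℕ → ((ℕ → B) → ℝ) → ℝ
  | 0, f => f fun _ => default
  | N + 1, f => Finset.univ.expect fun b => seqExpect N fun ζ => f (seqCons b ζ)

section seqExpect

variable {B : Type*} [Fintype B] [Inhabited B]

lemma seqExpect_mono {N : ℕ} {f g : (ℕ → B) → ℝ} (h : ∀ ζ, f ζ ≤ g ζ) :
    seqExpect N f ≤ seqExpect N g := by
  induction N generalizing f g with
  | zero => exact h _
  | succ N ih => exact Finset.expect_le_expect fun b _ => ih fun ζ => h _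

lemma seqExpect_const (N : ℕ) (x : ℝ) : seqExpect N (fun _ : ℕ → B => x) = x := by
  induction N with
  | zero => rfl
  | succ N ih => simp [seqExpect, ih]

lemma seqExpect_add (N : ℕ) (f g : (ℕ → B) → ℝ) :
    seqExpect N (fun ζ => f ζ + g ζ) = seqExpect N f + seqExpect N g := by
  induction N generalizing f g with
  | zero => rfl
  | succ N ih => simp [seqExpect, ih, Finset.expect_add_distrib]

lemma seqExpect_mul_left (N : ℕ) (x : ℝ) (f : (ℕ → B) → ℝ) :
    seqExpect N (fun ζ => x * f ζ) = x * seqExpect N f := by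
  induction N generalizing f with
  | zero => rfl
  | succ N ih => simp [seqExpect, ih, Finset.mul_expect]

lemma seqExpect_sub (N : ℕ) (f g : (ℕ → B) → ℝ) :
    seqExpect N (fun ζ => f ζ - g ζ) = seqExpect N f - seqExpect N g := by
  have h := seqExpect_add N f (fun ζ => (-1) * g ζ)
  rw [seqExpect_mul_left] at h
  simpa [sub_eq_add_neg] using h

lemma seqExpect_sum {ι : Type*} (N : ℕ) (s : Finset ι) (f : ι → (ℕ → B) → ℝ) :
    seqExpect N (fun ζ => ∑ i ∈ s, f i ζ) = ∑ i ∈ s, seqExpect N (f i) := by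
  classical
  induction s using Finset.induction_on with
  | empty => simpa using seqExpect_const N (0 : ℝ)
  | insert i s hi ih => simp only [Finset.sum_insert hi, seqExpect_add, ih]

/-- The inner average is the conditional expectation given the first `j` terms; the Markov property
is used in this form. -/
lemma seqExpect_append (j M : ℕ) (f : (ℕ → B) → ℝ) :
    seqExpect (j + M) f = seqExpect j fun η => seqExpect M fun ζ => f (seqAppend j η ζ) := by
  induction j generalizing f with
  | zero => simp [seqExpect, seqAppend_zero]
  | succ j ih =>
    rw [show j + 1 + M = (j + M) + 1 by ring]
    simp only [seqExpect, ih, seqAppend_succ]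

/-- Averaging over the second component of one of the terms does not change the expectation. -/
lemma seqExpect_resample_snd {C D : Type*} [Fintype C] [Fintype D] [Inhabited C] [Inhabited D]
    {s N : ℕ} (hs : s < N) (f : (ℕ → C × D) → ℝ) :
    seqExpect N f = seqExpect N fun ζ =>
      Finset.univ.expect fun d : D => f (Function.update ζ s ((ζ s).1, d)) := by
  induction s generalizing N f with
  | zero =>
    obtain ⟨N, rfl⟩ := Nat.exists_eq_succ_of_ne_zero hs.ne'
    simp only [seqExpect, update_seqCons_zero]
    have h1 : ∀ g : C × D → ℝ, Finset.univ.expect g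
        = Finset.univ.expect fun c : C => Finset.univ.expect fun d : D => g (c, d) := fun g => by
      rw [← Finset.univ_product_univ, Finset.expect_product]
    have h2 : ∀ b : C × D, seqExpect N (fun ζ => Finset.univ.expect fun d : D =>
        f (seqCons (b.1, d) ζ)) = Finset.univ.expect fun d : D =>
          seqExpect N fun ζ => f (seqCons (b.1, d) ζ) := fun b => by
      have := seqExpect_mul_left N ((Fintype.card D : ℝ)⁻¹)
        (fun ζ => ∑ d : D, f (seqCons (b.1, d) ζ))
      simp only [Fintype.expect_eq_sum_div_card, div_eq_inv_mul, this, seqExpect_sum]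
    simp only [seqCons, h2]
    rw [h1, h1]
    simp
  | succ s ih =>
    obtain ⟨N, rfl⟩ := Nat.exists_eq_succ_of_ne_zero (Nat.ne_of_gt (Nat.zero_lt_of_lt hs))
    simp only [seqExpect, update_seqCons_succ, seqCons]
    refine Finset.expect_congr rfl fun b _ => ?_
    exact ih (by omega) _

/-- The expectation as an average over finite sequences. -/
lemma seqExpect_eq_sum (N : ℕ) (f : (ℕ → B) → ℝ) :
    seqExpect N f = ∑ x : Fin N → B, ((Fintype.card B : ℝ)⁻¹) ^ N *
      f (fun t => if h : t < N then x ⟨t, h⟩ else default) := by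
  induction N generalizing f with
  | zero => simp [seqExpect]
  | succ N ih =>
    rw [← (Fin.consEquiv fun _ : Fin (N + 1) => B).sum_comp, Fintype.sum_prod_type]
    simp only [seqExpect, ih, Fintype.expect_eq_sum_div_card, div_eq_inv_mul, Finset.mul_sum]
    refine Finset.sum_congr rfl fun b _ => Finset.sum_congr rfl fun x _ => ?_
    rw [← mul_assoc, pow_succ']
    congr 2
    funext t
    cases t with
    | zero => simp [seqCons, Fin.consEquiv]
    | succ t =>
      by_cases h : t < N
      · simp only [seqCons, h, dif_pos, Nat.add_lt_add_iff_right, Fin.consEquiv]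
        exact (Fin.cons_succ (α := fun _ => B) b x ⟨t, h⟩).symm
      · simp [seqCons, h]

end seqExpect

-- Pathwise dynamics: clocks, epochs, loads and level sets.

/-- The input of one time step: the restart edges at a time `t` and the labels for the step
from time `t` to time `t + 1`. -/
abbrev StepInput {V : Type*} (G : SimpleGraph V) (k : ℕ) : Type _ :=
  (Fin 2 → G.Dart) × (Fin 2 → Fin (k - 1))

/-- The trajectory of the two walkers, as a function of the sequence of step inputs. -/
noncomputable def walkTraj {V : Type*} {G : SimpleGraph V} {k : ℕ} (T : NBLabelling G k) (L : ℕ)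
    (η : ℕ → StepInput G k) : ℕ → WalkState G
  | 0 => WalkState.fresh (η 0).1
  | t + 1 => (walkTraj T L η t).next T L (η t).2 (η (t + 1)).1

/-- The number of bins of load at least `i`. -/
def levelSet {V : Type*} [Fintype V] [DecidableEq V] {G : SimpleGraph V} (τ : TieRule G)
    (w : ℕ → WalkState G) (i t : ℕ) : Finset V :=
  Finset.univ.filter fun v => i ≤ loads τ w t v

section dynamics

variable {V : Type*} {G : SimpleGraph V} {k : ℕ} (T : NBLabelling G k) (L : ℕ)

/-- With the labels shifted by one time unit, the future after a restart at time `r` is a function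
of the inputs of index at least `r` alone. -/
lemma walkers_eq_walkTraj (u : Fin 2 → ℕ → Fin (k - 1) × G.Dart) :
    walkers T L u = walkTraj T L fun t => (fun j => (u j t).2, fun j => (u j (t + 1)).1) := by
  funext t
  induction t with
  | zero => rfl
  | succ t ih => simp only [walkers, walkTraj, ih]

variable {T L}

lemma WalkState.next_of_restarts {s : WalkState G} {d : Fin 2 → Fin (k - 1)}
    (h : s.Restarts T L d) (r : Fin 2 → G.Dart) : s.next T L d r = WalkState.fresh r :=
  if_pos h

lemma WalkState.next_of_not_restarts {s : WalkState G} {d : Fin 2 → Fin (k - 1)}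
    (h : ¬ s.Restarts T L d) (r : Fin 2 → G.Dart) : s.next T L d r =
    { edge := fun j => T.step (s.edge j) (d j)
      visited := s.visited ∪ {v | ∃ j, v = (T.step (s.edge j) (d j)).snd}
      clock := s.clock + 1 } :=
  if_neg h

lemma WalkState.clock_next_le (s : WalkState G) (d : Fin 2 → Fin (k - 1)) (r : Fin 2 → G.Dart) :
    (s.next T L d r).clock ≤ s.clock + 1 := by
  by_cases h : s.Restarts T L d
  · simp [WalkState.next_of_restarts h, WalkState.fresh]
  · simp [WalkState.next_of_not_restarts h]

lemma WalkState.clock_next_eq_zero_iff (s : WalkState G) (d : Fin 2 → Fin (k - 1))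
    (r : Fin 2 → G.Dart) : (s.next T L d r).clock = 0 ↔ s.Restarts T L d := by
  by_cases h : s.Restarts T L d
  · simp [WalkState.next_of_restarts h, WalkState.fresh, h]
  · simp [WalkState.next_of_not_restarts h, h]

variable (η : ℕ → StepInput G k)

lemma clock_add_le (r s : ℕ) :
    (walkTraj T L η (r + s)).clock ≤ (walkTraj T L η r).clock + s := by
  induction s with
  | zero => simp
  | succ s ih =>
    have := WalkState.clock_next_le (T := T) (L := L) (walkTraj T L η (r + s)) (η (r + s)).2
      (η (r + s + 1)).1
    change (walkTraj T L η (r + s + 1)).clock ≤ _ at this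
    rw [← add_assoc]
    omega

lemma clock_le (t : ℕ) : (walkTraj T L η t).clock ≤ t := by
  have h := clock_add_le (T := T) (L := L) η 0 t
  simpa [walkTraj, WalkState.fresh] using h

lemma clock_lt (hL : 0 < L) (t : ℕ) : (walkTraj T L η t).clock < L := by
  induction t with
  | zero => simpa [walkTraj, WalkState.fresh] using hL
  | succ t ih =>
    by_cases h : (walkTraj T L η t).Restarts T L (η t).2
    · simpa [walkTraj, WalkState.next_of_restarts h, WalkState.fresh] using hL
    · simp only [walkTraj, WalkState.next_of_not_restarts h]
      have : (walkTraj T L η t).clock + 1 ≠ L := fun h' => h (Or.inr h')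
      omega

lemma not_restarts_of_clock_succ {t s : ℕ} (h : (walkTraj T L η (t + 1)).clock = s + 1) :
    ¬ (walkTraj T L η t).Restarts T L (η t).2 ∧ (walkTraj T L η t).clock = s := by
  have h' : ¬ (walkTraj T L η t).Restarts T L (η t).2 := by
    rw [← WalkState.clock_next_eq_zero_iff _ _ (η (t + 1)).1]
    change (walkTraj T L η (t + 1)).clock ≠ 0
    omega
  refine ⟨h', ?_⟩
  simp only [walkTraj, WalkState.next_of_not_restarts h'] at h
  omega

lemma clock_sub_of_le {t s : ℕ} (hs : s ≤ (walkTraj T L η t).clock) :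
    (walkTraj T L η (t - s)).clock = (walkTraj T L η t).clock - s := by
  induction s with
  | zero => simp
  | succ s ih =>
    have h1 := ih (by omega)
    have h2 := clock_le (T := T) (L := L) η t
    obtain ⟨t', ht'⟩ : ∃ t', t - s = t' + 1 := ⟨t - s - 1, by omega⟩
    have h3 : t - (s + 1) = t' := by omega
    rw [h3]
    rw [ht'] at h1
    exact (not_restarts_of_clock_succ (s := (walkTraj T L η t).clock - (s + 1)) η
      (by rw [h1]; omega)).2

lemma clock_sub_clock (t : ℕ) :
    (walkTraj T L η (t - (walkTraj T L η t).clock)).clock = 0 := by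
  rw [clock_sub_of_le η le_rfl, Nat.sub_self]

lemma walkTraj_of_clock_eq_zero {t : ℕ} (h : (walkTraj T L η t).clock = 0) :
    walkTraj T L η t = WalkState.fresh (η t).1 := by
  cases t with
  | zero => rfl
  | succ t =>
    exact WalkState.next_of_restarts ((WalkState.clock_next_eq_zero_iff _ _ _).1 h) _

/-- After a restart the trajectory starts afresh. -/
lemma walkTraj_add_of_clock_eq_zero {r : ℕ} (h : (walkTraj T L η r).clock = 0) (s : ℕ) :
    walkTraj T L η (r + s) = walkTraj T L (fun t => η (r + t)) s := by
  induction s with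
  | zero => simpa [walkTraj] using walkTraj_of_clock_eq_zero η h
  | succ s ih => rw [← add_assoc]; simp only [walkTraj, ih]; rfl

variable {η}

lemma walkTraj_congr {η' : ℕ → StepInput G k} {t : ℕ} (h : ∀ s < t, η s = η' s)
    (ht : (η t).1 = (η' t).1) : walkTraj T L η t = walkTraj T L η' t := by
  induction t with
  | zero => simp [walkTraj, ht]
  | succ t ih =>
    simp only [walkTraj, ht, h t (Nat.lt_succ_self t)]
    rw [ih (fun s hs => h s (by omega)) (by rw [h t (Nat.lt_succ_self t)])]

/-- Unlike the full state, the clock does not involve the input of index `t`: whether `t` is a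
restart is decided before the new epoch is drawn. -/
lemma clock_congr {η' : ℕ → StepInput G k} {t : ℕ} (h : ∀ s < t, η s = η' s) :
    (walkTraj T L η t).clock = (walkTraj T L η' t).clock := by
  cases t with
  | zero => rfl
  | succ t =>
    have h1 : walkTraj T L η t = walkTraj T L η' t :=
      walkTraj_congr (fun s hs => h s (by omega)) (by rw [h t (Nat.lt_succ_self t)])
    simp only [walkTraj, h1, h t (Nat.lt_succ_self t)]
    by_cases h' : (walkTraj T L η' t).Restarts T L (η' t).2
    · simp [WalkState.next_of_restarts h', WalkState.fresh]
    · simp [WalkState.next_of_not_restarts h']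

lemma exists_chosenBin_eq_pos (τ : TieRule G) (w : ℕ → WalkState G) (q : V → ℕ) (t : ℕ) :
    ∃ j, chosenBin τ w q t = (w t).pos j := by
  unfold chosenBin
  split_ifs <;> exact ⟨_, rfl⟩

/-- The preference for the less loaded bin enters the proof only through this inequality, which is
blind to ties. -/
lemma chosenBin_le (τ : TieRule G) (w : ℕ → WalkState G) (q : V → ℕ) (t : ℕ) (j : Fin 2) :
    q (chosenBin τ w q t) ≤ q ((w t).pos j) := by
  unfold chosenBin
  split_ifs with h1 h2
  · fin_cases j <;> simp <;> omega
  · fin_cases j <;> simp <;> omega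
  · have : q ((w t).pos 0) = q ((w t).pos 1) := by omega
    have h3 : ∀ l : Fin 2, q ((w t).pos l) = q ((w t).pos 0) := fun l => by
      fin_cases l <;> simp [this]
    rw [h3, h3 j]

lemma pos_mem_visited (η : ℕ → StepInput G k) (t : ℕ) (j : Fin 2) :
    (walkTraj T L η t).pos j ∈ (walkTraj T L η t).visited := by
  cases t with
  | zero => exact ⟨j, rfl⟩
  | succ t =>
    by_cases h : (walkTraj T L η t).Restarts T L (η t).2
    · simp only [walkTraj, WalkState.next_of_restarts h]
      exact ⟨j, rfl⟩
    · simp only [walkTraj, WalkState.next_of_not_restarts h]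
      exact Or.inr ⟨j, rfl⟩

variable [DecidableEq V] (τ : TieRule G)

lemma loads_congr {w w' : ℕ → WalkState G} {t : ℕ} (h : ∀ s < t, w s = w' s) :
    loads τ w t = loads τ w' t := by
  induction t with
  | zero => rfl
  | succ t ih =>
    simp only [loads, ih fun s hs => h s (by omega)]
    have h1 : (fun s : Fin (t + 1) => w s) = fun s : Fin (t + 1) => w' s :=
      funext fun s => h s s.2
    simp only [chosenBin, h t (Nat.lt_succ_self t), h1]

lemma loads_mono (w : ℕ → WalkState G) : Monotone (loads τ w) :=
  monotone_nat_of_le_succ fun t v => by simp [loads]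

lemma loads_succ_of_ne_pos (w : ℕ → WalkState G) (t : ℕ) {v : V} (h : ∀ j, v ≠ (w t).pos j) :
    loads τ w (t + 1) v = loads τ w t v := by
  obtain ⟨j, hj⟩ := exists_chosenBin_eq_pos τ w (loads τ w t) t
  have : v ≠ chosenBin τ w (loads τ w t) t := by rw [hj]; exact h j
  simp [loads, this]

lemma loads_succ_of_not_mem_visited (η : ℕ → StepInput G k) (t : ℕ) {v : V}
    (hv : v ∉ (walkTraj T L η t).visited) :
    loads τ (walkTraj T L η) (t + 1) v
      = loads τ (walkTraj T L η) (t - (walkTraj T L η t).clock) v := by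
  have h0 : ∀ t, v ∉ (walkTraj T L η t).visited →
      loads τ (walkTraj T L η) (t + 1) v = loads τ (walkTraj T L η) t v := fun t ht =>
    loads_succ_of_ne_pos τ _ t fun j hj => ht (hj ▸ pos_mem_visited η t j)
  induction t with
  | zero => simpa using h0 0 hv
  | succ t ih =>
    rw [h0 _ hv]
    by_cases h : (walkTraj T L η t).Restarts T L (η t).2
    · have h1 := (WalkState.clock_next_eq_zero_iff _ _ (η (t + 1)).1).2 h
      have h2 : (walkTraj T L η (t + 1)).clock = 0 := h1
      simp [h2]
    · simp only [walkTraj, WalkState.next_of_not_restarts h] at hv ⊢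
      rw [ih fun h' => hv (Or.inl h'), Nat.add_sub_add_right]

/-- A bin has the same load when it is visited as at the preceding restart. -/
lemma loads_pos (η : ℕ → StepInput G k) (t : ℕ) (j : Fin 2) :
    loads τ (walkTraj T L η) t ((walkTraj T L η t).pos j)
      = loads τ (walkTraj T L η) (t - (walkTraj T L η t).clock) ((walkTraj T L η t).pos j) := by
  rcases hc : (walkTraj T L η t).clock with _ | s
  · simp
  cases t with
  | zero => simp [walkTraj, WalkState.fresh] at hc
  | succ t =>
    obtain ⟨h1, h2⟩ := not_restarts_of_clock_succ η hc
    have h3 : (walkTraj T L η (t + 1)).pos j ∉ (walkTraj T L η t).visited := fun h => h1 <| by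
      simp only [walkTraj, WalkState.next_of_not_restarts h1] at h
      exact Or.inl ⟨j, h⟩
    rw [loads_succ_of_not_mem_visited τ η t h3, h2, Nat.add_sub_add_right]

variable [Fintype V]

lemma sum_loads (w : ℕ → WalkState G) (t : ℕ) : ∑ v, loads τ w t v = t := by
  induction t with
  | zero => simp [loads]
  | succ t ih => simp [loads, Finset.sum_add_distrib, ih, Finset.sum_pi_single']

lemma card_levelSet_mul_le (w : ℕ → WalkState G) (i t : ℕ) :
    (levelSet τ w i t).card * i ≤ t := by
  calc (levelSet τ w i t).card * i = ∑ _v ∈ levelSet τ w i t, i := by simp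
    _ ≤ ∑ v ∈ levelSet τ w i t, loads τ w t v :=
        Finset.sum_le_sum fun v hv => (Finset.mem_filter.1 hv).2
    _ ≤ ∑ v, loads τ w t v := Finset.sum_le_sum_of_subset (Finset.subset_univ _)
    _ = t := sum_loads τ w t

lemma levelSet_mono (w : ℕ → WalkState G) (i : ℕ) : Monotone (levelSet τ w i) :=
  fun _ _ h _ hv => Finset.mem_filter.2
    ⟨Finset.mem_univ _, (Finset.mem_filter.1 hv).2.trans (loads_mono τ w h _)⟩

lemma levelSet_congr {w w' : ℕ → WalkState G} (i : ℕ) {t : ℕ} (h : ∀ s < t, w s = w' s) :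
    levelSet τ w i t = levelSet τ w' i t := by
  simp only [levelSet, loads_congr τ h]

/-- The times before `t` at which both walkers stand at bins that had load at least `i` at the
last restart. -/
def doubleHits (w : ℕ → WalkState G) (i t : ℕ) : Finset ℕ :=
  (Finset.range t).filter fun s =>
    ∀ j, (w s).pos j ∈ levelSet τ w i (s - (w s).clock)

/-- Each ball creates at most one new bin of load `i + 1`, and only if both offered bins have load
at least `i`; by `loads_pos` they had it at the last restart already. -/
lemma card_levelSet_succ_le (η : ℕ → StepInput G k) (i t : ℕ) :
    (levelSet τ (walkTraj T L η) (i + 1) t).card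
      ≤ (doubleHits τ (walkTraj T L η) i t).card := by
  set w := walkTraj T L η with hw
  induction t with
  | zero => simp [levelSet, loads]
  | succ t ih =>
    by_cases h : i ≤ loads τ w t (chosenBin τ w (loads τ w t) t)
    · have h1 : levelSet τ w (i + 1) (t + 1)
          ⊆ insert (chosenBin τ w (loads τ w t) t) (levelSet τ w (i + 1) t) := fun v hv => by
        by_cases hvc : v = chosenBin τ w (loads τ w t) t
        · simp [hvc]
        · simpa [levelSet, loads, Pi.single_apply, hvc] using hv
      have h2 : doubleHits τ w i (t + 1) = insert t (doubleHits τ w i t) := by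
        rw [doubleHits, Finset.range_add_one, Finset.filter_insert, if_pos]
        · rfl
        · intro j
          refine Finset.mem_filter.2 ⟨Finset.mem_univ _, ?_⟩
          rw [hw, ← loads_pos τ η t j]
          exact h.trans (chosenBin_le τ _ _ t j)
      have h3 : t ∉ doubleHits τ w i t := by simp [doubleHits]
      rw [h2, Finset.card_insert_of_notMem h3]
      exact (Finset.card_le_card h1).trans ((Finset.card_insert_le _ _).trans (by omega))
    · have h1 : levelSet τ w (i + 1) (t + 1) ⊆ levelSet τ w (i + 1) t := fun v hv => by
        by_cases hvc : v = chosenBin τ w (loads τ w t) t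
        · simp only [levelSet, loads, Finset.mem_filter, ← hvc, Pi.add_apply,
            Pi.single_eq_same] at hv
          rw [← hvc] at h
          omega
        · simpa [levelSet, loads, Pi.single_apply, hvc] using hv
      refine (Finset.card_le_card h1).trans (ih.trans (Finset.card_le_card ?_))
      exact Finset.filter_subset_filter _ (Finset.range_mono (Nat.le_succ t))

end dynamics

-- Stationarity of the non-backtracking step.

section uniformity

variable {V : Type*} {G : SimpleGraph V} {k : ℕ} (T : NBLabelling G k) (L : ℕ)

/-- Reversal of a non-backtracking step. -/
def NBLabelling.reverse (p : G.Dart × Fin (k - 1)) : G.Dart × Fin (k - 1) :=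
  ((T.step p.1 p.2).symm,
    (T (T.step p.1 p.2).symm).symm ⟨p.1.fst, p.1.adj.symm, (T p.1 p.2).2.2.symm⟩)

lemma NBLabelling.step_reverse (p : G.Dart × Fin (k - 1)) :
    T.step (T.reverse p).1 (T.reverse p).2 = p.1.symm := by
  ext
  · rfl
  · exact congrArg Subtype.val (Equiv.apply_symm_apply (T (T.step p.1 p.2).symm) _)

lemma NBLabelling.reverse_involutive : Function.Involutive T.reverse := by
  intro p
  have h1 : (T.step (T.reverse p).1 (T.reverse p).2).symm = p.1 := by
    rw [T.step_reverse, SimpleGraph.Dart.symm_symm]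
  have h2 : ∀ (e : G.Dart) (h : G.Adj e.snd (T p.1 p.2).1 ∧ (T p.1 p.2).1 ≠ e.fst), e = p.1 →
      (T e).symm ⟨(T p.1 p.2).1, h⟩ = p.2 := by
    rintro e h rfl
    simp
  exact Prod.ext h1 (h2 _ _ h1)

variable [Fintype G.Dart]

/-- The uniform distribution on pairs of directed edges is stationary. -/
lemma NBLabelling.expect_step [Inhabited (Fin (k - 1))] (f : (Fin 2 → G.Dart) → ℝ) :
    (Finset.univ.expect fun e : Fin 2 → G.Dart => Finset.univ.expect
      fun d : Fin 2 → Fin (k - 1) => f fun j => T.step (e j) (d j))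
      = Finset.univ.expect f := by
  -- Reversal permutes the pairs (edge, label) and turns the edge after the step into the reverse of
  -- the edge before it.
  have h1 : ∑ p : Fin 2 → G.Dart × Fin (k - 1), f (fun j => T.step (p j).1 (p j).2)
      = ∑ p : Fin 2 → G.Dart × Fin (k - 1), f fun j => (p j).1.symm := by
    rw [← (Equiv.piCongrRight fun _ : Fin 2 => T.reverse_involutive.toPerm).sum_comp]
    refine Finset.sum_congr rfl fun p _ => ?_
    congr 1
    funext j
    exact T.step_reverse (p j)
  have h2 : ∀ g : (Fin 2 → G.Dart) → (Fin 2 → Fin (k - 1)) → ℝ,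
      ∑ e, ∑ d, g e d = ∑ p : Fin 2 → G.Dart × Fin (k - 1), g (fun j => (p j).1)
        fun j => (p j).2 := fun g => by
    rw [← Fintype.sum_prod_type', ← (Equiv.arrowProdEquivProdArrow _ _ _).sum_comp]
    rfl
  have h3 : ∑ e : Fin 2 → G.Dart, f (fun j => (e j).symm) = ∑ e, f e := by
    rw [← (Equiv.piCongrRight fun _ : Fin 2 =>
      SimpleGraph.Dart.symm_involutive.toPerm).sum_comp (fun e => f e)]
    rfl
  have h4 := h2 fun e d => f fun j => T.step (e j) (d j)
  have h5 := h2 fun e _ => f fun j => (e j).symm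
  simp only at h4 h5
  simp only [Fintype.expect_eq_sum_div_card, ← Finset.sum_div]
  rw [h4, h1, ← h5]
  simp only [Finset.sum_const, Finset.card_univ, nsmul_eq_mul]
  rw [← Finset.mul_sum, h3]
  rw [mul_div_cancel_left₀]
  exact_mod_cast Fintype.card_ne_zero

variable [Inhabited G.Dart] [Inhabited (Fin (k - 1))]

/-- Up to the first restart, the walkers are dominated by a uniform pair of directed edges. -/
lemma seqExpect_edge_le {s M : ℕ} (hs : s < M) (f : (Fin 2 → G.Dart) → ℝ) (hf : ∀ e, 0 ≤ f e) :
    seqExpect M (fun ζ : ℕ → StepInput G k =>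
      if (walkTraj T L ζ s).clock = s then f (walkTraj T L ζ s).edge else 0)
      ≤ Finset.univ.expect f := by
  induction s generalizing f with
  | zero =>
    obtain ⟨M, rfl⟩ := Nat.exists_eq_succ_of_ne_zero hs.ne'
    simp only [walkTraj, WalkState.fresh, if_true, seqExpect, seqCons, seqExpect_const]
    rw [← Finset.univ_product_univ, Finset.expect_product]
    simp
  | succ s ih =>
    -- The last step is averaged out: the induction hypothesis is applied to the one-step average of
    -- `f`, which has the same mean as `f`. Steps that end the epoch contribute 0, which is no loss
    -- since `f` is nonnegative.
    have h1 := ih (by omega) (fun e => Finset.univ.expect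
      fun d : Fin 2 → Fin (k - 1) => f fun j => T.step (e j) (d j))
      (fun e => Finset.expect_nonneg fun d _ => hf _)
    rw [T.expect_step] at h1
    refine le_trans ?_ h1
    rw [seqExpect_resample_snd (show s < M by omega)]
    refine seqExpect_mono fun ζ => ?_
    have h2 : ∀ d, walkTraj T L (Function.update ζ s ((ζ s).1, d)) s = walkTraj T L ζ s :=
      fun d => walkTraj_congr (fun t ht => by rw [Function.update_of_ne ht.ne]) (by simp)
    split_ifs with h
    · refine Finset.expect_le_expect fun d _ => ?_
      split_ifs with h'
      · have h3 := (not_restarts_of_clock_succ _ h').1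
        have h4 : (walkTraj T L (Function.update ζ s ((ζ s).1, d)) (s + 1)).edge
            = fun j => T.step ((walkTraj T L ζ s).edge j) (d j) := by
          simp only [walkTraj]
          rw [WalkState.next_of_not_restarts h3, h2]
          simp
        rw [h4]
      · exact hf _
    · refine le_of_eq (Finset.expect_eq_zero fun d _ => if_neg fun h' => h ?_)
      have h3 := (not_restarts_of_clock_succ _ h').2
      rwa [h2] at h3

end uniformity

/-- In a regular graph the head of a uniform directed edge is uniform. -/
lemma expect_snd_mem {V : Type*} [Fintype V] [DecidableEq V] {G : SimpleGraph V}
    [DecidableRel G.Adj] {k : ℕ} (hk : k ≠ 0) (hG : G.IsRegularOfDegree k) (S : Finset V) :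
    (Finset.univ.expect fun e : Fin 2 → G.Dart => if ∀ j, (e j).snd ∈ S then (1 : ℝ) else 0)
      = ((S.card : ℝ) / Fintype.card V) ^ 2 := by
  have h1 : ∀ v, (Finset.univ.filter fun e : G.Dart => e.snd = v).card = k := fun v => by
    rw [← hG v, ← G.dart_fst_fiber_card_eq_degree v]
    refine Finset.card_bij (fun e _ => e.symm) (fun e he => ?_) (fun e _ e' _ h => ?_)
      (fun e he => ⟨e.symm, ?_, e.symm_symm⟩)
    · simpa using he
    · exact SimpleGraph.Dart.symm_involutive.injective h
    · simpa using he
  have h2 : ∀ S : Finset V, (Finset.univ.filter fun e : G.Dart => e.snd ∈ S).card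
      = S.card * k := fun S => by
    rw [Finset.card_eq_sum_card_fiberwise (f := fun e : G.Dart => e.snd) (t := S)]
    · rw [Finset.sum_congr rfl (g := fun _ => k), Finset.sum_const, smul_eq_mul]
      intro v hv
      rw [← h1 v, Finset.filter_filter]
      congr 1
      ext e
      simp only [Finset.mem_filter, Finset.mem_univ, true_and]
      exact ⟨fun h => h.2, fun h => ⟨h ▸ hv, h⟩⟩
    · intro e he
      simpa using he
  have h3 : Fintype.card G.Dart = Fintype.card V * k := by
    have := h2 Finset.univ
    simpa using this
  have h4 : (Finset.univ.filter fun e : Fin 2 → G.Dart => ∀ j, (e j).snd ∈ S)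
      = Fintype.piFinset fun _ => Finset.univ.filter fun e : G.Dart => e.snd ∈ S := by
    ext e
    simp
  rw [Fintype.expect_eq_sum_div_card, Finset.sum_boole, h4, Fintype.card_piFinset]
  simp only [h2, h3, Fintype.card_fun, Finset.prod_const, Finset.card_univ, Fintype.card_fin]
  push_cast
  rw [← div_pow, mul_div_mul_right]
  exact_mod_cast hk

-- The exponential supermartingale along epochs.

section potential

variable {V : Type*} [Fintype V] [DecidableEq V] {G : SimpleGraph V} {k : ℕ}
  (T : NBLabelling G k) (L : ℕ) (τ : TieRule G)

/-- The number of simultaneous visits of `S` up to the first restart, compensated by `a` per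
time step and divided by `L`. -/
noncomputable def epochPotential (a : ℝ) (S : Finset V) (ζ : ℕ → StepInput G k) : ℝ :=
  (∑ s ∈ Finset.range L, if (walkTraj T L ζ s).clock = s then
    (if ∀ j, (walkTraj T L ζ s).pos j ∈ S then (1 : ℝ) else 0) - a else 0) / L

/-- The sum of the potentials of the epochs that start before `t` while at most `β` bins have load
at least `i`. -/
noncomputable def walkPotential (a β : ℝ) (i t : ℕ) (η : ℕ → StepInput G k) : ℝ :=
  ∑ r ∈ Finset.range t, if (walkTraj T L η r).clock = 0 ∧
      ((levelSet τ (walkTraj T L η) i r).card : ℝ) ≤ β then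
    epochPotential T L a (levelSet τ (walkTraj T L η) i r) (fun s => η (r + s)) else 0

variable {T L}

/-- Each summand looks up to `L` steps ahead, so the potential is in general not determined by the
past; at a restart it is, since all earlier epochs are over. -/
lemma walkPotential_congr {a β : ℝ} {i t : ℕ} {η η' : ℕ → StepInput G k}
    (h : ∀ s < t, η s = η' s) (ht : (walkTraj T L η t).clock = 0) :
    walkPotential T L τ a β i t η = walkPotential T L τ a β i t η' := by
  have ht' : (walkTraj T L η' t).clock = 0 := by rw [← ht, clock_congr h]
  have h0 : ∀ s < t, walkTraj T L η s = walkTraj T L η' s := fun s hs =>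
    walkTraj_congr (fun r hr => h r (hr.trans hs)) (by rw [h s hs])
  refine Finset.sum_congr rfl fun r hr => ?_
  rw [Finset.mem_range] at hr
  rw [h0 r hr, levelSet_congr τ i fun s hs => h0 s (hs.trans hr)]
  by_cases hc : (walkTraj T L η' r).clock = 0
  swap
  · simp [hc]
  refine if_congr Iff.rfl ?_ rfl
  unfold epochPotential
  congr 1
  refine Finset.sum_congr rfl fun s _ => ?_
  have hcr : (walkTraj T L η r).clock = 0 := by rw [h0 r hr, hc]
  rw [← walkTraj_add_of_clock_eq_zero η hcr, ← walkTraj_add_of_clock_eq_zero η' hc]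
  rcases lt_or_ge (r + s) t with hs | hs
  · rw [h0 _ hs]
  -- The clock, being 0 at `t`, is at most `r + s - t < s` at time `r + s`.
  · have h1 : ∀ ξ : ℕ → StepInput G k, (walkTraj T L ξ t).clock = 0 →
        (walkTraj T L ξ (r + s)).clock ≠ s := fun ξ hξ h2 => by
      have := clock_add_le (T := T) (L := L) ξ t (r + s - t)
      rw [hξ, Nat.add_sub_cancel' hs, h2] at this
      omega
    rw [if_neg (h1 η ht), if_neg (h1 η' ht')]

/-- Division by `L` puts the hit term in `[0, 1]`, where `exp x ≤ 1 + 2 * x`. A full epoch gains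
`exp (-a) ≤ 1 / (1 + a) ≤ 1 - a / 2`; for a shorter one the factor is merely bounded by 1. -/
lemma exp_epochPotential_le (hL : 0 < L) {a : ℝ} (ha0 : 0 ≤ a) (ha1 : a ≤ 1)
    (S : Finset V) (ζ : ℕ → StepInput G k) :
    Real.exp (epochPotential T L a S ζ) ≤ 1
      - a / 2 * (if (walkTraj T L ζ (L - 1)).clock = L - 1 then 1 else 0)
      + 2 / L * ∑ s ∈ Finset.range L, if (walkTraj T L ζ s).clock = s then
        (if ∀ j, ((walkTraj T L ζ s).edge j).snd ∈ S then (1 : ℝ) else 0) else 0 := by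
  set H : ℝ := ∑ s ∈ Finset.range L, if (walkTraj T L ζ s).clock = s then
        (if ∀ j, ((walkTraj T L ζ s).edge j).snd ∈ S then (1 : ℝ) else 0) else 0 with hH
  set A : ℝ := ∑ s ∈ Finset.range L, if (walkTraj T L ζ s).clock = s then (1 : ℝ) else 0 with hA
  have hL' : (0 : ℝ) < L := by exact_mod_cast hL
  have h1 : epochPotential T L a S ζ = H / L + -(a * (A / L)) := by
    rw [epochPotential, ← mul_div_assoc, ← sub_eq_add_neg, ← sub_div, hH, hA, Finset.mul_sum,
      ← Finset.sum_sub_distrib]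
    congr 1
    refine Finset.sum_congr rfl fun s _ => ?_
    split_ifs <;> first | rfl | simp_all [WalkState.pos]
  have hH0 : 0 ≤ H := Finset.sum_nonneg fun s _ => by split_ifs <;> norm_num
  have hA0 : 0 ≤ A := Finset.sum_nonneg fun s _ => by split_ifs <;> norm_num
  have hH1 : H / L ≤ 1 := by
    rw [div_le_one hL']
    calc H ≤ ∑ s ∈ Finset.range L, (1 : ℝ) :=
          Finset.sum_le_sum fun s _ => by split_ifs <;> norm_num
      _ = L := by simp
  have hH2 : 0 ≤ H / L := by positivity
  have h2 : Real.exp (H / L) ≤ 1 + 2 * (H / L) := by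
    have := Real.abs_exp_sub_one_sub_id_le (x := H / L) (by rwa [abs_of_nonneg hH2])
    have := (abs_le.1 this).2
    nlinarith
  have h3 : Real.exp (-(a * (A / L))) ≤ 1
      - a / 2 * (if (walkTraj T L ζ (L - 1)).clock = L - 1 then 1 else 0) := by
    split_ifs with h
    · have hAL : A = L := by
        rw [hA]
        rw [Finset.sum_congr rfl (g := fun _ => (1 : ℝ))]
        · simp
        · intro s hs
          rw [Finset.mem_range] at hs
          have := clock_sub_of_le (T := T) (L := L) ζ (t := L - 1) (s := L - 1 - s) (by omega)
          rw [h, show L - 1 - (L - 1 - s) = s by omega] at this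
          rw [if_pos this]
      rw [hAL, div_self hL'.ne', mul_one]
      have := Real.abs_exp_sub_one_sub_id_le (x := -a) (by rwa [abs_neg, abs_of_nonneg ha0])
      have := (abs_le.1 this).2
      have h4 : Real.exp (-a) ≤ 1 / (1 + a) := by
        rw [Real.exp_neg, ← one_div]
        exact one_div_le_one_div_of_le (by linarith) (by linarith [Real.add_one_le_exp a])
      refine h4.trans ?_
      rw [div_le_iff₀ (by linarith)]
      nlinarith
    · rw [mul_zero, sub_zero, Real.exp_le_one_iff]
      have : 0 ≤ a * (A / L) := by positivity
      linarith
  have h4 : Real.exp (-(a * (A / L))) ≤ 1 := by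
    rw [Real.exp_le_one_iff]
    have : 0 ≤ a * (A / L) := by positivity
    linarith
  rw [h1, Real.exp_add]
  calc Real.exp (H / L) * Real.exp (-(a * (A / L)))
      ≤ (1 + 2 * (H / L)) * Real.exp (-(a * (A / L))) :=
        mul_le_mul_of_nonneg_right h2 (Real.exp_pos _).le
    _ ≤ Real.exp (-(a * (A / L))) + 2 * (H / L) := by nlinarith
    _ ≤ _ := by rw [show 2 / (L : ℝ) * H = 2 * (H / L) by ring]; linarith

/-- The potential bounds the number of double hits: the last restart and the clock determine the
time. -/
lemma walkPotential_ge {a β : ℝ} (hL : 0 < L) (ha : 0 ≤ a) (i n : ℕ) (η : ℕ → StepInput G k) :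
    (if ((levelSet τ (walkTraj T L η) i n).card : ℝ) ≤ β then
        ((doubleHits τ (walkTraj T L η) i n).card : ℝ) else 0) - a * (n + L)
      ≤ L * walkPotential T L τ a β i n η := by
  have hL' : (0 : ℝ) < L := by exact_mod_cast hL
  set w := walkTraj T L η with hw
  -- Pairs (restart, clock) of the counted epochs. The time `r + s` determines the pair, and is
  -- below `n + L` because the last epoch may run past `n`.
  set D := (Finset.range n ×ˢ Finset.range L).filter fun p : ℕ × ℕ =>
    ((w p.1).clock = 0 ∧ ((levelSet τ w i p.1).card : ℝ) ≤ β) ∧ (w (p.1 + p.2)).clock = p.2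
    with hD
  have h1 : L * walkPotential T L τ a β i n η
      = ((D.filter fun p => ∀ j, (w (p.1 + p.2)).pos j ∈ levelSet τ w i p.1).card : ℝ)
        - a * D.card := by
    have h2 : (D.card : ℝ) = ∑ p ∈ D, 1 := by simp
    rw [← Finset.sum_boole, h2, Finset.mul_sum, ← Finset.sum_sub_distrib, hD, Finset.sum_filter,
      Finset.sum_product, walkPotential, Finset.mul_sum]
    refine Finset.sum_congr rfl fun r _ => ?_
    split_ifs with h
    · rw [epochPotential, mul_div_cancel₀ _ hL'.ne']
      refine Finset.sum_congr rfl fun s _ => ?_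
      rw [← walkTraj_add_of_clock_eq_zero η h.1, ← hw]
      exact if_congr (and_iff_right h).symm (by rw [mul_one]) rfl
    · rw [mul_zero]
      refine (Finset.sum_eq_zero fun s _ => if_neg fun h' => h h'.1).symm
  have h2 : D.card ≤ n + L := by
    rw [← Finset.card_range (n + L)]
    refine Finset.card_le_card_of_injOn (fun p => p.1 + p.2) (fun p hp => ?_)
      fun p hp q hq hpq => ?_
    · simp only [hD, Finset.coe_filter, Set.mem_ofPred_eq, Finset.mem_product,
        Finset.mem_range] at hp
      simp only [Finset.coe_range, Set.mem_Iio]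
      omega
    · simp only [hD, Finset.coe_filter, Set.mem_ofPred_eq] at hp hq
      have h3 : p.2 = q.2 := by rw [← hp.2.2, ← hq.2.2]; exact congrArg (fun t => (w t).clock) hpq
      simp only at hpq
      exact Prod.ext (by omega) h3
  -- Level sets grow, so a bound at time `n` holds at every earlier restart and no epoch is left
  -- out.
  have h3 : ((levelSet τ w i n).card : ℝ) ≤ β → (doubleHits τ w i n).card
      ≤ (D.filter fun p => ∀ j, (w (p.1 + p.2)).pos j ∈ levelSet τ w i p.1).card := fun hβ => by
    refine Finset.card_le_card_of_injOn (fun t => (t - (w t).clock, (w t).clock))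
      (fun t ht => ?_) fun t _ t' _ h => ?_
    · simp only [doubleHits, Finset.coe_filter, Finset.mem_range, Set.mem_ofPred_eq] at ht
      have h4 : t - (w t).clock + (w t).clock = t := Nat.sub_add_cancel (clock_le η t)
      simp only [hD, Finset.coe_filter, Finset.mem_filter, Finset.mem_product, Finset.mem_range,
        Set.mem_ofPred_eq, h4]
      refine ⟨⟨⟨by omega, clock_lt η hL t⟩, ⟨clock_sub_clock η t, ?_⟩, trivial⟩, ht.2⟩
      refine le_trans ?_ hβ
      exact_mod_cast Finset.card_le_card (levelSet_mono τ w i (by omega))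
    · have h5 := clock_le (T := T) (L := L) η t
      have h6 := clock_le (T := T) (L := L) η t'
      simp only [Prod.mk.injEq] at h
      simp only [hw] at h
      omega
  have h4 : a * (D.card : ℝ) ≤ a * (n + L) :=
    mul_le_mul_of_nonneg_left (by exact_mod_cast h2) ha
  rw [h1]
  split_ifs with h
  · have : ((doubleHits τ w i n).card : ℝ) ≤ _ := Nat.cast_le.2 (h3 h)
    linarith
  · have : (0 : ℝ) ≤ ((D.filter fun p => ∀ j, (w (p.1 + p.2)).pos j
      ∈ levelSet τ w i p.1).card : ℝ) := Nat.cast_nonneg _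
    linarith

variable [DecidableRel G.Adj] [Inhabited G.Dart] [Inhabited (Fin (k - 1))]

/-- The gain `a / 2 * (9 / 10)` from full epochs outweighs the mean hit term, at most twice the
squared density of `S`. -/
lemma seqExpect_exp_epochPotential_le (hL : 0 < L) (hk : k ≠ 0) (hG : G.IsRegularOfDegree k)
    {M : ℕ} (hM : L ≤ M) {a : ℝ} (ha1 : a ≤ 1) (S : Finset V)
    (hN : 9 / 10 ≤ seqExpect M fun ζ : ℕ → StepInput G k =>
      if (walkTraj T L ζ (L - 1)).clock = L - 1 then (1 : ℝ) else 0)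
    (ha : 2 * ((S.card : ℝ) / Fintype.card V) ^ 2 ≤ 9 / 20 * a) :
    seqExpect M (fun ζ => Real.exp (epochPotential T L a S ζ)) ≤ 1 := by
  have ha0 : 0 ≤ a := by nlinarith [sq_nonneg ((S.card : ℝ) / Fintype.card V)]
  have hL' : (0 : ℝ) < L := by exact_mod_cast hL
  refine (seqExpect_mono fun ζ => exp_epochPotential_le hL ha0 ha1 S ζ).trans ?_
  rw [seqExpect_add, seqExpect_sub, seqExpect_const, seqExpect_mul_left, seqExpect_mul_left,
    seqExpect_sum]
  have h1 : ∑ s ∈ Finset.range L, seqExpect M (fun ζ : ℕ → StepInput G k =>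
      if (walkTraj T L ζ s).clock = s then
        (if ∀ j, ((walkTraj T L ζ s).edge j).snd ∈ S then (1 : ℝ) else 0) else 0)
      ≤ L * ((S.card : ℝ) / Fintype.card V) ^ 2 := by
    rw [← nsmul_eq_mul, ← Finset.card_range L, ← Finset.sum_const, Finset.card_range]
    refine Finset.sum_le_sum fun s hs => ?_
    rw [← expect_snd_mem hk hG S]
    exact seqExpect_edge_le T L ((Finset.mem_range.1 hs).trans_le hM)
      (fun e => if ∀ j, (e j).snd ∈ S then (1 : ℝ) else 0) fun e => by split_ifs <;> norm_num
  have h2 := mul_le_mul_of_nonneg_left h1 (by positivity : (0 : ℝ) ≤ 2 / L)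
  have h3 := mul_le_mul_of_nonneg_left hN (by positivity : 0 ≤ a / 2)
  have h4 : 2 / (L : ℝ) * (L * ((S.card : ℝ) / Fintype.card V) ^ 2)
      = 2 * ((S.card : ℝ) / Fintype.card V) ^ 2 := by field_simp
  linarith

/-- The exponential of the potential is a supermartingale. -/
lemma seqExpect_exp_walkPotential_le (hL : 0 < L) (hk : k ≠ 0) (hG : G.IsRegularOfDegree k)
    {n : ℕ} {a β : ℝ} (ha1 : a ≤ 1) (i : ℕ)
    (hN : ∀ M, L ≤ M → 9 / 10 ≤ seqExpect M fun ζ : ℕ → StepInput G k =>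
      if (walkTraj T L ζ (L - 1)).clock = L - 1 then (1 : ℝ) else 0)
    (ha : 2 * (β / Fintype.card V) ^ 2 ≤ 9 / 20 * a) :
    seqExpect (n + L) (fun η => Real.exp (walkPotential T L τ a β i n η)) ≤ 1 := by
  suffices h : ∀ t ≤ n,
      seqExpect (n + L) (fun η => Real.exp (walkPotential T L τ a β i t η)) ≤ 1 from h n le_rfl
  intro t
  induction t with
  | zero => intro _; simp [walkPotential, seqExpect_const]
  | succ t ih =>
    intro ht
    refine le_trans ?_ (ih (by omega))
    obtain ⟨M, hM⟩ : ∃ M, n + L = t + M := ⟨n + L - t, by omega⟩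
    rw [hM, seqExpect_append, seqExpect_append]
    refine seqExpect_mono fun η => ?_
    have h0 : ∀ ζ s, s < t → seqAppend t η ζ s = η s := fun ζ s hs => by simp [seqAppend, hs]
    have hw : ∀ ζ s, s < t → walkTraj T L (seqAppend t η ζ) s = walkTraj T L η s := fun ζ s hs =>
      walkTraj_congr (fun r hr => h0 ζ r (hr.trans hs)) (by rw [h0 ζ s hs])
    have hS : ∀ ζ, levelSet τ (walkTraj T L (seqAppend t η ζ)) i t
        = levelSet τ (walkTraj T L η) i t := fun ζ => levelSet_congr τ i (hw ζ)
    have hc : ∀ ζ, (walkTraj T L (seqAppend t η ζ) t).clock = (walkTraj T L η t).clock :=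
      fun ζ => clock_congr (h0 ζ)
    have h1 : ∀ ζ, walkPotential T L τ a β i (t + 1) (seqAppend t η ζ)
        = walkPotential T L τ a β i t (seqAppend t η ζ)
          + if (walkTraj T L η t).clock = 0 ∧
              ((levelSet τ (walkTraj T L η) i t).card : ℝ) ≤ β then
            epochPotential T L a (levelSet τ (walkTraj T L η) i t) ζ else 0 := fun ζ => by
      rw [walkPotential, Finset.sum_range_succ, hS, hc]
      congr 2
      congr 1
      funext s
      simp [seqAppend]
    -- At a restart with a small level set the old potential is fixed and the new epoch is driven by
    -- the fresh inputs `ζ`, of which at least `L` remain. Otherwise nothing is added.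
    by_cases h : (walkTraj T L η t).clock = 0 ∧
        ((levelSet τ (walkTraj T L η) i t).card : ℝ) ≤ β
    · simp only [h1, if_pos h]
      have h2 : ∀ ζ, walkPotential T L τ a β i t (seqAppend t η ζ)
          = walkPotential T L τ a β i t η := fun ζ =>
        walkPotential_congr τ (h0 ζ) (by rw [hc, h.1])
      simp only [h2, Real.exp_add, seqExpect_mul_left, seqExpect_const]
      refine mul_le_of_le_one_right (Real.exp_pos _).le ?_
      refine seqExpect_exp_epochPotential_le hL hk hG (by omega) ha1 _ (hN M (by omega)) ?_
      refine le_trans ?_ ha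
      gcongr
      exact h.2
    · simp only [h1, if_neg h, add_zero, le_refl]

end potential

-- Transfer from the probability space to finite averages.

section uniformInput

variable {Ω V : Type*} [MeasurableSpace Ω] {P : Measure Ω} [IsProbabilityMeasure P]
  {G : SimpleGraph V} {k : ℕ} {U : Fin 2 → ℕ → Ω → Fin (k - 1) × G.Dart}

/-- The sequence of step inputs extracted from the input of the scheme. -/
def stepInputs (U : Fin 2 → ℕ → Ω → Fin (k - 1) × G.Dart) (ω : Ω) (t : ℕ) : StepInput G k :=
  (fun j => (U j t ω).2, fun j => (U j (t + 1) ω).1)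

variable [Fintype G.Dart]

lemma IsUniformInput.measurableSet_preimage (hU : IsUniformInput P U) (j : Fin 2) (t : ℕ)
    (F : Finset (Fin (k - 1) × G.Dart)) : MeasurableSet (U j t ⁻¹' F) := by
  have : MeasurableSingletonClass G.Dart := ⟨fun _ => trivial⟩
  exact hU.measurable j t F.measurableSet

lemma IsUniformInput.real_preimage (hU : IsUniformInput P U) (j : Fin 2) (t : ℕ)
    (F : Finset (Fin (k - 1) × G.Dart)) :
    P.real (U j t ⁻¹' F) = F.card / (Fintype.card (Fin (k - 1)) * Fintype.card G.Dart) := by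
  classical
  induction F using Finset.induction_on with
  | empty => simp
  | insert x F hx ih =>
    have h1 : U j t ⁻¹' (insert x F : Finset _) = {ω | U j t ω = x} ∪ U j t ⁻¹' F := by
      ext ω
      simp
    rw [h1, measureReal_union ?_ (hU.measurableSet_preimage j t F), ih,
      Finset.card_insert_of_notMem hx, measureReal_def, hU.uniform, Nat.card_eq_fintype_card,
      Fintype.card_prod]
    · rw [ENNReal.toReal_inv, ENNReal.toReal_natCast]
      push_cast
      ring
    · rw [Set.disjoint_left]
      rintro ω rfl
      exact hx

lemma IsUniformInput.real_stepInputs_eq [Nonempty G.Dart] [Nonempty (Fin (k - 1))]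
    (hU : IsUniformInput P U) (N : ℕ)
    (x : ℕ → StepInput G k) : MeasurableSet {ω | ∀ t < N, stepInputs U ω t = x t} ∧
    P.real {ω | ∀ t < N, stepInputs U ω t = x t}
      = ((Fintype.card (StepInput G k) : ℝ)⁻¹) ^ N := by
  classical
  -- The first `N` step inputs use labels of times `1, …, N` and edges of times `0, …, N - 1`. The
  -- label at time 0 and the edges from time `N` on stay free, so `N + 1` times yield the power `N`.
  let A : Fin 2 → ℕ → Finset (Fin (k - 1)) := fun j t =>
    Nat.casesOn t Finset.univ fun t => {(x t).2 j}
  let B : Fin 2 → ℕ → Finset G.Dart := fun j t => if t < N then {(x t).1 j} else Finset.univ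
  let s : Fin 2 × ℕ → Finset (Fin (k - 1) × G.Dart) := fun p => A p.1 p.2 ×ˢ B p.1 p.2
  have hset : {ω | ∀ t < N, stepInputs U ω t = x t}
      = ⋂ p ∈ (Finset.univ : Finset (Fin 2)) ×ˢ Finset.range (N + 1), U p.1 p.2 ⁻¹' s p := by
    ext ω
    simp only [Set.mem_ofPred_eq, Set.mem_iInter, Set.mem_preimage, Finset.mem_coe,
      Finset.mem_product, Finset.mem_univ, true_and, Finset.mem_range, s]
    constructor
    · rintro h ⟨j, t⟩ ht
      constructor
      · cases t with
        | zero => simp [A]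
        | succ t => simp [A, ← h t (by simpa using ht), stepInputs]
      · by_cases ht' : t < N
        · simp [B, ht', ← h t ht', stepInputs]
        · simp [B, ht']
    · intro h t ht
      refine Prod.ext (funext fun j => ?_) (funext fun j => ?_)
      · have h1 := (h (j, t) (by simp; omega)).2
        simpa [B, ht, stepInputs] using h1
      · have h1 := (h (j, t + 1) (by simpa using ht)).1
        simpa [A, stepInputs] using h1
  have hmeas : ∀ p, MeasurableSet (U p.1 p.2 ⁻¹' s p) := fun p =>
    hU.measurableSet_preimage p.1 p.2 (s p)
  have : MeasurableSingletonClass G.Dart := ⟨fun _ => trivial⟩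
  refine ⟨hset ▸ Finset.measurableSet_biInter _ fun p _ => hmeas p, ?_⟩
  have hind := hU.indep.measure_inter_preimage_eq_mul
    ((Finset.univ : Finset (Fin 2)) ×ˢ Finset.range (N + 1)) (sets := fun p => (s p : Set _))
    fun p _ => (s p).measurableSet
  have hA : ∀ j, ∏ t ∈ Finset.range (N + 1), ((A j t).card : ℝ) = Fintype.card (Fin (k - 1)) :=
    fun j => by
      rw [Finset.prod_range_succ']
      simp [A]
  have hB : ∀ j, ∏ t ∈ Finset.range (N + 1), ((B j t).card : ℝ) = Fintype.card G.Dart :=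
    fun j => by
      rw [Finset.prod_range_succ, Finset.prod_eq_one]
      · simp [B]
      · intro t ht
        simp [B, Finset.mem_range.1 ht]
  have hK : (Fintype.card (Fin (k - 1)) : ℝ) ≠ 0 := by exact_mod_cast Fintype.card_ne_zero
  have hD : (Fintype.card G.Dart : ℝ) ≠ 0 := by exact_mod_cast Fintype.card_ne_zero
  rw [hset, measureReal_def, hind, ENNReal.toReal_prod]
  have h1 : ∀ p, (P (U p.1 p.2 ⁻¹' (s p : Set _))).toReal = (A p.1 p.2).card * (B p.1 p.2).card
      / ((Fintype.card (Fin (k - 1)) : ℝ) * Fintype.card G.Dart) := fun p => by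
    rw [← measureReal_def, hU.real_preimage, Finset.card_product, Nat.cast_mul]
  have h2 : ∀ j, ∏ t ∈ Finset.range (N + 1), ((A j t).card : ℝ) * (B j t).card
      / ((Fintype.card (Fin (k - 1)) : ℝ) * Fintype.card G.Dart)
      = (((Fintype.card (Fin (k - 1)) : ℝ) * Fintype.card G.Dart) ^ N)⁻¹ := fun j => by
    rw [Finset.prod_div_distrib, Finset.prod_mul_distrib, hA, hB, Finset.prod_const,
      Finset.card_range, pow_succ]
    field_simp
  simp only [h1, Finset.prod_product, h2, Finset.prod_const, Fintype.card_prod, Fintype.card_fun,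
    Finset.card_univ]
  rw [← inv_pow, ← pow_mul, mul_comm N, pow_mul, inv_pow]
  push_cast
  simp only [Fintype.card_fin]
  congr 1
  ring

/-- The probability of an event that depends on the first `N` step inputs. -/
lemma IsUniformInput.real_eq_seqExpect [Inhabited G.Dart] [Inhabited (Fin (k - 1))]
    (hU : IsUniformInput P U) (N : ℕ) (Q : (ℕ → StepInput G k) → Prop) [DecidablePred Q]
    (hQ : ∀ η η' : ℕ → StepInput G k, (∀ t < N, η t = η' t) → Q η → Q η') :
    P.real {ω | Q (stepInputs U ω)} = seqExpect N fun η => if Q η then 1 else 0 := by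
  classical
  let e : (Fin N → StepInput G k) → ℕ → StepInput G k := fun x t =>
    if h : t < N then x ⟨t, h⟩ else default
  have h1 : {ω | Q (stepInputs U ω)} = ⋃ x ∈ Finset.univ.filter fun x => Q (e x),
      {ω | ∀ t < N, stepInputs U ω t = e x t} := by
    ext ω
    simp only [Set.mem_ofPred_eq, Set.mem_iUnion, Finset.mem_filter, Finset.mem_univ, true_and,
      exists_prop]
    constructor
    · intro h
      have h2 : ∀ t < N, stepInputs U ω t = e (fun t => stepInputs U ω t) t := fun t ht => by
        simp [e, ht]
      exact ⟨fun t => stepInputs U ω t, hQ _ _ h2 h, h2⟩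
    · rintro ⟨x, hx, h⟩
      exact hQ _ _ (fun t ht => (h t ht).symm) hx
  rw [h1, measureReal_biUnion_finset, seqExpect_eq_sum, Finset.sum_filter]
  · refine Finset.sum_congr rfl fun x _ => ?_
    rw [(hU.real_stepInputs_eq N (e x)).2, mul_ite, mul_one, mul_zero]
  · intro x _ y _ hxy
    refine Set.disjoint_left.2 fun ω hx hy => hxy (funext fun t => ?_)
    have h2 := (hx t t.2).symm.trans (hy t t.2)
    simpa [e] using h2
  · exact fun x _ => (hU.real_stepInputs_eq N (e x)).1

end uniformInput

-- From one level to the next.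

section layers

variable {V : Type*} [Fintype V] [DecidableEq V] {G : SimpleGraph V} {k : ℕ}
  {T : NBLabelling G k} {L : ℕ} (τ : TieRule G)
  [DecidableRel G.Adj] [Inhabited G.Dart] [Inhabited (Fin (k - 1))]

variable (T L) in
/-- The probability that more than `β` bins have load at least `i` at time `n`. -/
noncomputable def levelTail (n i : ℕ) (β : ℝ) : ℝ :=
  seqExpect (n + L) fun η : ℕ → StepInput G k =>
    if β < ((levelSet τ (walkTraj T L η) i n).card : ℝ) then 1 else 0

lemma levelTail_eq_zero {n i : ℕ} {β : ℝ} (h : (n : ℝ) ≤ β * i) (hi : 0 < i) :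
    levelTail T L τ n i β = 0 := by
  refine Eq.trans ?_ (seqExpect_const (B := StepInput G k) (n + L) 0)
  refine congrArg _ (funext fun η => ?_)
  refine if_neg fun h' => ?_
  have h1 : (((levelSet τ (walkTraj T L η) i n).card * i : ℕ) : ℝ) ≤ n :=
    Nat.cast_le.2 (card_levelSet_mul_le τ _ i n)
  have hi' : (0 : ℝ) < i := by exact_mod_cast hi
  push_cast at h1
  nlinarith

/-- Chernoff: if level `i` is small and level `i + 1` exceeds `β'`, then `walkPotential_ge` forces
the potential to be at least `b`. -/
lemma levelTail_succ_le_add_exp (hL : 0 < L) (hk : k ≠ 0) (hG : G.IsRegularOfDegree k)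
    {n : ℕ} {a β β' b : ℝ} (ha0 : 0 ≤ a) (ha1 : a ≤ 1) (i : ℕ)
    (hN : ∀ M, L ≤ M → 9 / 10 ≤ seqExpect M fun ζ : ℕ → StepInput G k =>
      if (walkTraj T L ζ (L - 1)).clock = L - 1 then (1 : ℝ) else 0)
    (ha : 2 * (β / Fintype.card V) ^ 2 ≤ 9 / 20 * a) (hβ : a * (n + L) + b * L ≤ β') :
    levelTail T L τ n (i + 1) β' ≤ levelTail T L τ n i β + Real.exp (-b) := by
  have hL' : (0 : ℝ) < L := by exact_mod_cast hL
  have h1 := seqExpect_exp_walkPotential_le (n := n) τ hL hk hG ha1 i hN ha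
  have h2 := mul_le_mul_of_nonneg_left h1 (Real.exp_pos (-b)).le
  rw [mul_one] at h2
  refine le_trans ?_ (add_le_add_right h2 _)
  rw [levelTail, levelTail, ← seqExpect_mul_left, ← seqExpect_add]
  refine seqExpect_mono fun η => ?_
  have h3 := walkPotential_ge (T := T) (β := β) τ hL ha0 i n η
  have h4 : ((levelSet τ (walkTraj T L η) (i + 1) n).card : ℝ)
      ≤ (doubleHits τ (walkTraj T L η) i n).card := Nat.cast_le.2 (card_levelSet_succ_le τ η i n)
  rw [← Real.exp_add]
  have h5 := Real.exp_pos (-b + walkPotential T L τ a β i n η)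
  by_cases h6 : β < ((levelSet τ (walkTraj T L η) i n).card : ℝ)
  · rw [if_pos h6]
    split_ifs <;> linarith
  · rw [if_neg h6, zero_add]
    split_ifs with h7
    · rw [if_pos (not_lt.1 h6)] at h3
      have h8 : L * b ≤ L * walkPotential T L τ a β i n η := by linarith
      rw [Real.one_le_exp_iff]
      linarith [le_of_mul_le_mul_left h8 hL']
    · exact h5.le

/-- Markov, avoiding the additive `b * L`. With `Φ` the potential, `exp Φ - 1 ≥ Φ` shows that `L *
(exp Φ - 1) + a * (n + L)` is nonnegative and dominates the double hits when level `i` is small; by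
the supermartingale its mean is at most `a * (n + L)`. -/
lemma levelTail_succ_le_add_inv (hL : 0 < L) (hk : k ≠ 0) (hG : G.IsRegularOfDegree k)
    {n : ℕ} {a β β' D : ℝ} (ha0 : 0 < a) (ha1 : a ≤ 1) (hD : 0 < D) (i : ℕ)
    (hN : ∀ M, L ≤ M → 9 / 10 ≤ seqExpect M fun ζ : ℕ → StepInput G k =>
      if (walkTraj T L ζ (L - 1)).clock = L - 1 then (1 : ℝ) else 0)
    (ha : 2 * (β / Fintype.card V) ^ 2 ≤ 9 / 20 * a) (hβ : D * (a * (n + L)) ≤ β') :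
    levelTail T L τ n (i + 1) β' ≤ levelTail T L τ n i β + 1 / D := by
  have hL' : (0 : ℝ) < L := by exact_mod_cast hL
  have hA : 0 < a * (n + L) := by positivity
  have h1 := seqExpect_exp_walkPotential_le (n := n) τ hL hk hG ha1 i hN ha
  have h2 : seqExpect (n + L) (fun η => (D * (a * (n + L)))⁻¹ *
      (L * (Real.exp (walkPotential T L τ a β i n η) - 1) + a * (n + L))) ≤ 1 / D := by
    rw [seqExpect_mul_left, seqExpect_add, seqExpect_const, seqExpect_mul_left, seqExpect_sub,
      seqExpect_const, inv_mul_le_iff₀ (by positivity)]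
    have h3 : D * (a * (n + L)) * (1 / D) = a * (n + L) := by field_simp
    rw [h3]
    nlinarith
  refine le_trans ?_ (add_le_add_right h2 _)
  rw [levelTail, levelTail, ← seqExpect_add]
  refine seqExpect_mono fun η => ?_
  have h3 := walkPotential_ge (T := T) (β := β) τ hL ha0.le i n η
  have h4 : ((levelSet τ (walkTraj T L η) (i + 1) n).card : ℝ)
      ≤ (doubleHits τ (walkTraj T L η) i n).card := Nat.cast_le.2 (card_levelSet_succ_le τ η i n)
  have h5 : L * walkPotential T L τ a β i n η
      ≤ L * (Real.exp (walkPotential T L τ a β i n η) - 1) :=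
    mul_le_mul_of_nonneg_left
      (by linarith [Real.add_one_le_exp (walkPotential T L τ a β i n η)]) hL'.le
  have h0 : 0 ≤ (D * (a * (n + L)))⁻¹ *
      (L * (Real.exp (walkPotential T L τ a β i n η) - 1) + a * (n + L)) := by
    refine mul_nonneg (by positivity) ?_
    have : (0 : ℝ) ≤ if ((levelSet τ (walkTraj T L η) i n).card : ℝ) ≤ β then
        ((doubleHits τ (walkTraj T L η) i n).card : ℝ) else 0 := by split_ifs <;> positivity
    linarith
  by_cases h6 : β < ((levelSet τ (walkTraj T L η) i n).card : ℝ)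
  · rw [if_pos h6]
    split_ifs <;> linarith
  · rw [if_neg h6, zero_add]
    split_ifs with h7
    · rw [if_pos (not_lt.1 h6)] at h3
      rw [← div_eq_inv_mul, one_le_div (by positivity)]
      linarith
    · exact h0

end layers

-- The doubly exponential recursion.

/-- For `x = q / 20`, the term `10 * x ^ 2` is half of the next fraction `q ^ 2 / 20`; the other
half absorbs `b * L`, the last layer being the tightest. -/
lemma le_of_squaring_recursion {p : ℕ → ℝ → ℝ} {n L b : ℝ} {I : ℕ} (hn : 0 < n)
    (hp0 : p 40 (1 / 40 * n) ≤ 0)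
    (hp : ∀ (i : ℕ) (x β' : ℝ), 0 ≤ x → 5 * x ^ 2 ≤ 1 → 10 * x ^ 2 * n + b * L ≤ β' →
        p (i + 1) β' ≤ p i (x * n) + Real.exp (-b))
    (hbL : 40 * (b * L) ≤ (1 / 2 : ℝ) ^ (2 ^ I) * n) :
    p (40 + I) ((1 / 2 : ℝ) ^ (2 ^ I) / 20 * n) ≤ I * Real.exp (-b) := by
  suffices h : ∀ j ≤ I, p (40 + j) ((1 / 2 : ℝ) ^ (2 ^ j) / 20 * n) ≤ j * Real.exp (-b) from
    h I le_rfl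
  intro j
  induction j with
  | zero => intro _; norm_num at hp0 ⊢; exact hp0
  | succ j ih =>
    intro hj
    have hqq : (1 / 2 : ℝ) ^ (2 ^ (j + 1)) = ((1 / 2 : ℝ) ^ (2 ^ j)) ^ 2 := by
      rw [← pow_mul, pow_succ]
    have hq0 : (0 : ℝ) ≤ (1 / 2 : ℝ) ^ (2 ^ j) := by positivity
    have hq1 : (1 / 2 : ℝ) ^ (2 ^ j) ≤ 1 := pow_le_one₀ (by norm_num) (by norm_num)
    have hq2 : (1 / 2 : ℝ) ^ (2 ^ I) * n ≤ (1 / 2 : ℝ) ^ (2 ^ (j + 1)) * n :=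
      mul_le_mul_of_nonneg_right (pow_le_pow_of_le_one (by norm_num) (by norm_num)
        (Nat.pow_le_pow_right (by norm_num) hj)) hn.le
    have ih' := ih (by omega)
    rw [hqq] at hq2 ⊢
    generalize (1 / 2 : ℝ) ^ (2 ^ j) = q at *
    have h6 := hp (40 + j) (q / 20) (q ^ 2 / 20 * n) (by positivity) (by nlinarith) (by
      have : 10 * (q / 20) ^ 2 * n = q ^ 2 * n / 40 := by ring
      linarith)
    rw [← add_assoc]
    push_cast
    linarith

/-- The substitution `x = y / (10 * D)` turns `x ↦ D * (10 * x ^ 2)` into pure squaring of `y`. -/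
lemma le_of_scaled_squaring_recursion {p : ℕ → ℝ → ℝ} {n D z δ : ℝ} {i : ℕ} (hD : 1 ≤ D)
    (hz0 : 0 < z) (hz1 : z ≤ 1) (hp0 : p i (z / (10 * D) * n) ≤ δ)
    (hp : ∀ (i : ℕ) (x D : ℝ), 0 < x → 5 * x ^ 2 ≤ 1 → 0 < D →
        p (i + 1) (D * (10 * x ^ 2) * n) ≤ p i (x * n) + 1 / D) (m : ℕ) :
    p (i + m) (z ^ (2 ^ m) / (10 * D) * n) ≤ δ + m * (1 / D) := by
  induction m with
  | zero => simpa using hp0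
  | succ m ih =>
    have hzm : z ^ (2 ^ m) ≤ 1 := pow_le_one₀ hz0.le hz1
    have hzm0 : 0 < z ^ (2 ^ m) := by positivity
    rw [pow_succ 2 m, pow_mul]
    generalize z ^ (2 ^ m) = y at *
    have hD0 : 0 < D := by linarith
    have hx : y / (10 * D) ≤ 1 / 10 := by
      rw [div_le_div_iff₀ (by positivity) (by norm_num)]
      linarith
    have hx0 : 0 < y / (10 * D) := by positivity
    have h7 : D * (10 * (y / (10 * D)) ^ 2) = y ^ 2 / (10 * D) := by
      field_simp
    have h6 := hp (i + m) (y / (10 * D)) D hx0 (by nlinarith) hD0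
    rw [h7] at h6
    rw [← add_assoc]
    push_cast
    linarith

/-- Here `exp (log n * r)` stands for `n ^ r`. -/
lemma eventually_log_bounds {α : ℝ} (hα : 0 < α) (ε D : ℝ) : ∀ᶠ n : ℕ in Filter.atTop,
    4 / α ≤ Real.log n ∧ Real.log n ≤ Real.exp (Real.log n * (α / 4)) ∧
    80 ≤ Real.exp (Real.log n * (α / 4)) ∧ D ≤ Real.exp (Real.log n * (α / 16)) ∧
    ε ≤ (n : ℝ) := by
  have hlog : Filter.Tendsto (fun n : ℕ => Real.log n) Filter.atTop Filter.atTop :=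
    Real.tendsto_log_atTop.comp tendsto_natCast_atTop_atTop
  have hpow : ∀ r : ℝ, 0 < r → ∀ x : ℝ, ∀ᶠ n : ℕ in Filter.atTop,
      x ≤ Real.exp (Real.log n * r) := fun r hr x =>
    (Real.tendsto_exp_atTop.comp (hlog.atTop_mul_const hr)).eventually_ge_atTop x
  have h1 := (Real.isLittleO_pow_exp_atTop (n := 1)).bound (c := α / 4) (by positivity)
  have h2 := (hlog.atTop_mul_const (by positivity : 0 < α / 4)).eventually h1
  filter_upwards [hlog.eventually_ge_atTop (4 / α), h2, hlog.eventually_ge_atTop 0,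
    hpow (α / 4) (by positivity) 80, hpow (α / 16) (by positivity) D,
    (tendsto_natCast_atTop_atTop (R := ℝ)).eventually_ge_atTop ε] with n ha hb hc hd he hf
  refine ⟨ha, ?_, hd, he, hf⟩
  rw [Real.norm_of_nonneg (by positivity), Real.norm_of_nonneg (by positivity), pow_one,
    mul_comm (α / 4)] at hb
  exact le_of_mul_le_mul_right hb (by positivity)

/-- The recursion for the level sets leads in `log₂ log n + O(1)` layers to an empty one. -/
lemma exists_layer {α ε : ℝ} (hα : 0 < α) (hα1 : α < 1) (hε : 0 < ε) :
    ∃ n₀ : ℕ, ∀ n : ℕ, n₀ ≤ n → ∀ L : ℕ, (L : ℝ) ≤ (n : ℝ) ^ (1 - α) * Real.log n →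
      0 < n ∧ L ≤ n ∧ ∀ p : ℕ → ℝ → ℝ, p 40 (1 / 40 * n) ≤ 0 →
      (∀ (i : ℕ) (x b β' : ℝ), 0 ≤ x → 5 * x ^ 2 ≤ 1 → 10 * x ^ 2 * n + b * L ≤ β' →
        p (i + 1) β' ≤ p i (x * n) + Real.exp (-b)) →
      (∀ (i : ℕ) (x D : ℝ), 0 < x → 5 * x ^ 2 ≤ 1 → 0 < D →
        p (i + 1) (D * (10 * x ^ 2) * n) ≤ p i (x * n) + 1 / D) →
      ∃ m : ℕ, (m : ℝ) ≤ Real.logb 2 (Real.log n) + 44 ∧ ∃ β, β < 1 ∧ p m β ≤ ε := by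
  -- `J + 1` squarings take `n ^ (-α / 16)` below `1 / n`. The choice of `D` keeps the `J + 1`
  -- Markov errors below `ε / 2` in total.
  obtain ⟨J, hJ1, hJ2⟩ := exists_nat_pow_near (x := 16 / α) (y := 2)
    (by rw [le_div_iff₀ hα]; linarith) (by norm_num)
  rw [le_div_iff₀ hα] at hJ1
  rw [div_lt_iff₀ hα] at hJ2
  set D : ℝ := 2 * (J + 1) / ε + 1 with hD
  have hD1 : 1 ≤ D := by
    have : 0 ≤ 2 * (J + 1) / ε := by positivity
    linarith
  obtain ⟨n₀, hn₀⟩ := Filter.eventually_atTop.1 (eventually_log_bounds hα (2 / ε + 1) D)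
  refine ⟨n₀, fun n hn L hL => ?_⟩
  obtain ⟨h1, h2, h3, h4, h5⟩ := hn₀ n hn
  have hε2 : 0 < 2 / ε := by positivity
  have hn1 : (0 : ℝ) < n := by linarith
  set l := Real.log n with hl
  have hnl : (n : ℝ) = Real.exp l := (Real.exp_log hn1).symm
  have hl0 : 0 < l := lt_of_lt_of_le (by positivity) h1
  have hL' : (L : ℝ) ≤ Real.exp (l * (1 - α)) * l := by
    rwa [Real.rpow_def_of_pos hn1] at hL
  have hLn : (L : ℝ) ≤ n := by
    refine hL'.trans ((mul_le_mul_of_nonneg_left h2 (Real.exp_pos _).le).trans ?_)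
    rw [hnl, ← Real.exp_add, Real.exp_le_exp]
    nlinarith
  refine ⟨by exact_mod_cast hn1, by exact_mod_cast hLn, fun p hp0 hp1 hp2 => ?_⟩
  have hlog2 : 0 < Real.log 2 := Real.log_pos (by norm_num)
  have hlog2' : Real.log 2 ≤ 1 := by linarith [Real.log_two_lt_d9]
  have hlog2'' : 1 / 2 ≤ Real.log 2 := by linarith [Real.log_two_gt_d9]
  -- This places `(1 / 2) ^ (2 ^ I)` between `n ^ (-α / 4)`, large enough to absorb `b * L` for `b =
  -- 2 * l`, and `n ^ (-α / 8)`.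
  obtain ⟨I, hI1, hI2⟩ := exists_nat_pow_near (x := α / 4 * l / Real.log 2) (y := 2)
    (by
      rw [le_div_iff₀ hlog2, one_mul]
      rw [div_le_iff₀ hα] at h1
      linarith) (by norm_num)
  rw [le_div_iff₀ hlog2] at hI1
  rw [div_lt_iff₀ hlog2, pow_succ] at hI2
  have hq : (1 / 2 : ℝ) ^ (2 ^ I) = Real.exp (-(2 ^ I * Real.log 2)) := by
    rw [Real.exp_neg, one_div, inv_pow]
    congr 1
    have h6 := Real.exp_nat_mul (Real.log 2) (2 ^ I)
    rw [Real.exp_log (by norm_num)] at h6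
    rw [← h6]
    push_cast
    rfl
  have hI0 : (0 : ℝ) < 2 ^ I := by positivity
  have hI3 : (2 : ℝ) ^ I ≤ α / 2 * l := by nlinarith
  have hbL : 40 * (2 * l * L) ≤ (1 / 2 : ℝ) ^ (2 ^ I) * n := by
    have h6 : l * L ≤ l * (Real.exp (l * (1 - α)) * l) := mul_le_mul_of_nonneg_left hL' hl0.le
    have h7 : l * l ≤ Real.exp (l * (α / 4)) * Real.exp (l * (α / 4)) :=
      mul_le_mul h2 h2 hl0.le (Real.exp_pos _).le
    have h8 : 80 * (l * l)
        ≤ Real.exp (l * (α / 4)) * (Real.exp (l * (α / 4)) * Real.exp (l * (α / 4))) :=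
      mul_le_mul h3 h7 (by positivity) (Real.exp_pos _).le
    calc 40 * (2 * l * L) = 80 * (l * L) := by ring
      _ ≤ 80 * (l * (Real.exp (l * (1 - α)) * l)) := by linarith
      _ = 80 * (l * l) * Real.exp (l * (1 - α)) := by ring
      _ ≤ Real.exp (l * (α / 4)) * (Real.exp (l * (α / 4)) * Real.exp (l * (α / 4)))
          * Real.exp (l * (1 - α)) := mul_le_mul_of_nonneg_right h8 (Real.exp_pos _).le
      _ = Real.exp (-(α / 4 * l)) * n := by
          rw [hnl]
          simp only [← Real.exp_add]
          congr 1
          ring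
      _ ≤ (1 / 2 : ℝ) ^ (2 ^ I) * n := by
          rw [hq]
          refine mul_le_mul_of_nonneg_right ?_ hn1.le
          rw [Real.exp_le_exp]
          linarith
  have hA := le_of_squaring_recursion (L := L) hn1 hp0 (fun i x β' => hp1 i x (2 * l) β') hbL
  -- Then `z / (10 * D)` is the fraction at which the exponential phase stops.
  obtain ⟨z, hz⟩ : ∃ z : ℝ, z = D / 2 * (1 / 2 : ℝ) ^ (2 ^ I) := ⟨_, rfl⟩
  have hz0 : 0 < z := by rw [hz]; positivity
  have hz1 : z ≤ Real.exp (-(l * (α / 16))) := by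
    rw [hz]
    calc D / 2 * (1 / 2 : ℝ) ^ (2 ^ I) ≤ Real.exp (l * (α / 16)) * Real.exp (-(α / 8 * l)) := by
          refine mul_le_mul (by linarith) ?_ (by positivity) (Real.exp_pos _).le
          rw [hq, Real.exp_le_exp]
          linarith
      _ = Real.exp (-(l * (α / 16))) := by
          rw [← Real.exp_add]
          congr 1
          ring
  have hz2 : z ≤ 1 := hz1.trans (Real.exp_le_one_iff.2 (by
    have : 0 ≤ l * (α / 16) := by positivity
    linarith))
  have hB := le_of_scaled_squaring_recursion (i := 40 + I)
    (δ := I * Real.exp (-(2 * l))) hD1 hz0 hz2 (by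
    have h7 : z / (10 * D) = (1 / 2 : ℝ) ^ (2 ^ I) / 20 := by
      rw [hz]
      field_simp
      norm_num
    rw [h7]
    exact hA) hp2 (J + 1)
  refine ⟨40 + I + (J + 1), ?_, _, ?_, hB.trans ?_⟩
  -- From `2 ^ I ≤ α / 2 * l` and `2 ^ J ≤ 16 / α`: here `α` cancels, which makes the constant `40 +
  -- 3 + 1 = 44` absolute.
  · have h6 : (2 : ℝ) ^ (I + J) ≤ 8 * l := by
      rw [pow_add]
      have h7 : (0 : ℝ) < 2 ^ J := by positivity
      have h8 : (2 : ℝ) ^ I * 2 ^ J ≤ α / 2 * l * 2 ^ J :=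
        mul_le_mul_of_nonneg_right hI3 h7.le
      nlinarith
    have h7 : ((I + J : ℕ) : ℝ) ≤ Real.logb 2 (8 * l) := by
      rw [Real.le_logb_iff_rpow_le (by norm_num) (by positivity), Real.rpow_natCast]
      exact h6
    rw [Real.logb_mul (by norm_num) hl0.ne', show (8 : ℝ) = 2 ^ (3 : ℝ) by norm_num,
      Real.logb_rpow (by norm_num) (by norm_num)] at h7
    push_cast at h7 ⊢
    linarith
  · have h6 : z ^ (2 ^ (J + 1)) ≤ Real.exp (-l) := by
      refine (pow_le_pow_left₀ hz0.le hz1 _).trans ?_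
      rw [← Real.exp_nat_mul, Real.exp_le_exp]
      push_cast
      have h7 := mul_lt_mul_of_pos_right hJ2 hl0
      linarith
    have h7 : z ^ (2 ^ (J + 1)) * n ≤ 1 := by
      calc z ^ (2 ^ (J + 1)) * n ≤ Real.exp (-l) * n := mul_le_mul_of_nonneg_right h6 hn1.le
        _ = 1 := by rw [hnl, ← Real.exp_add]; simp
    rw [div_mul_eq_mul_div, div_lt_one (by positivity)]
    linarith
  · have h6 : (I : ℝ) ≤ Real.exp l := by
      have h7 : (I : ℝ) ≤ 2 ^ I := by exact_mod_cast Nat.lt_two_pow_self.le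
      have h8 := Real.add_one_le_exp l
      nlinarith
    have h7 : I * Real.exp (-(2 * l)) ≤ ε / 2 := by
      calc I * Real.exp (-(2 * l)) ≤ Real.exp l * Real.exp (-(2 * l)) :=
            mul_le_mul_of_nonneg_right h6 (Real.exp_pos _).le
        _ = (n : ℝ)⁻¹ := by
            rw [hnl, ← Real.exp_add, ← Real.exp_neg]
            congr 1
            ring
        _ ≤ ε / 2 := by
            rw [inv_le_comm₀ hn1 (by positivity), inv_div]
            linarith
    have h8 : ((J + 1 : ℕ) : ℝ) * (1 / D) ≤ ε / 2 := by
      rw [mul_one_div, div_le_iff₀ (by linarith), hD]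
      have : ε / 2 * (2 * (J + 1) / ε + 1) = J + 1 + ε / 2 := by field_simp
      rw [this]
      push_cast
      linarith
    linarith

-- Use of condition (N), and assembly.

/-- A restart is due at time `L` anyway, so a full epoch is recognised by its clock at time `L - 1`.
-/
lemma firstRestart_lt_of_clock_ne {V : Type*} {G : SimpleGraph V} {k : ℕ} {T : NBLabelling G k}
    {L : ℕ} (hL : 0 < L) (u : Fin 2 → ℕ → Fin (k - 1) × G.Dart)
    (h : (walkers T L u (L - 1)).clock ≠ L - 1) : firstRestart T L u < (L : ℕ∞) := by
  by_contra hlt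
  have h1 : ∀ t, t + 1 < L → ¬ (walkers T L u t).Restarts T L fun j => (u j (t + 1)).1 :=
    fun t ht hr => hlt (lt_of_le_of_lt (iInf₂_le t hr) (by exact_mod_cast ht))
  have h2 : ∀ t, t < L → (walkers T L u t).clock = t := fun t => by
    induction t with
    | zero => intro _; rfl
    | succ t ih =>
      intro ht
      simp only [walkers, WalkState.next_of_not_restarts (h1 t ht), ih (by omega)]
  exact h (h2 _ (by omega))

theorem mainTheorem1 :
    ∃ K : ℝ, ∀ α : ℝ, 0 < α → α < 1 → ∀ ε : ℝ, 0 < ε → ∃ n₀ : ℕ, ∀ n : ℕ, n₀ ≤ n →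
      ∀ c : ℝ, 1 ≤ c * Real.log n → c ≤ (n : ℝ) ^ (1 - α) →
      ∀ (k : ℕ) (G : SimpleGraph (Fin n)) [DecidableRel G.Adj],
        2 ≤ k → G.Connected → G.IsRegularOfDegree k →
      ∀ (T : NBLabelling G k) (τ : TieRule G)
        (Ω : Type*) [MeasurableSpace Ω] (P : Measure Ω) [IsProbabilityMeasure P]
        (U : Fin 2 → ℕ → Ω → Fin (k - 1) × G.Dart), IsUniformInput P U →
        P.real {ω | firstRestart T ⌊c * Real.log n⌋₊ (fun j t => U j t ω)
            < (⌊c * Real.log n⌋₊ : ℕ∞)} ≤ 0.1 →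
        1 - ε ≤ P.real {ω |
          (maxLoad τ (walkers T ⌊c * Real.log n⌋₊ (fun j t => U j t ω)) n : ℝ)
            ≤ Real.logb 2 (Real.log n) + K} := by
  refine ⟨44, fun α hα hα1 ε hε => ?_⟩
  obtain ⟨n₀, hn₀⟩ := exists_layer hα hα1 hε
  refine ⟨n₀, fun n hn c hc1 hc2 k G _ hk _ hG T τ Ω _ P _ U hU hN => ?_⟩
  set L := ⌊c * Real.log n⌋₊ with hLdef
  have hL : 0 < L := Nat.floor_pos.2 hc1
  obtain ⟨hn1, hLn, hlayer⟩ := hn₀ n hn L ((Nat.floor_le (by linarith)).trans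
    (mul_le_mul_of_nonneg_right hc2 (Real.log_natCast_nonneg n)))
  have hnR : (0 : ℝ) < n := by exact_mod_cast hn1
  have hLnR : (L : ℝ) ≤ n := by exact_mod_cast hLn
  have hk0 : k ≠ 0 := by omega
  have : Inhabited (Fin (k - 1)) := ⟨⟨0, by omega⟩⟩
  have : Inhabited G.Dart := Classical.inhabited_of_nonempty <| by
    have h1 : 0 < G.degree ⟨0, hn1⟩ := by rw [hG]; omega
    obtain ⟨w, hw⟩ := (G.degree_pos_iff_exists_adj _).1 h1
    exact ⟨(_, w), hw⟩
  have htraj : ∀ ω, walkers T L (fun j t => U j t ω) = walkTraj T L (stepInputs U ω) := fun ω =>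
    walkers_eq_walkTraj T L _
  have hcongr : ∀ (M t : ℕ) (η η' : ℕ → StepInput G k), (∀ s < M, η s = η' s) → t < M →
      walkTraj T L η t = walkTraj T L η' t := fun M t η η' h ht =>
    walkTraj_congr (fun s hs => h s (hs.trans ht)) (by rw [h t ht])
  have hN' : ∀ M, L ≤ M → 9 / 10 ≤ seqExpect M fun ζ : ℕ → StepInput G k =>
      if (walkTraj T L ζ (L - 1)).clock = L - 1 then (1 : ℝ) else 0 := fun M hM => by
    rw [← hU.real_eq_seqExpect M
      (fun ζ => (walkTraj T L ζ (L - 1)).clock = L - 1) fun η η' h h' => by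
        rwa [← hcongr M _ η η' h (by omega)]]
    have h1 : ({ω | firstRestart T L (fun j t => U j t ω) < (L : ℕ∞)} ∪
        {ω | (walkTraj T L (stepInputs U ω) (L - 1)).clock = L - 1}) = Set.univ := by
      refine Set.eq_univ_of_forall fun ω => ?_
      by_cases h : (walkTraj T L (stepInputs U ω) (L - 1)).clock = L - 1
      · exact Or.inr h
      · exact Or.inl (firstRestart_lt_of_clock_ne hL _ (by rwa [htraj]))
    have h2 := measureReal_union_le (μ := P)
      {ω | firstRestart T L (fun j t => U j t ω) < (L : ℕ∞)}
      {ω | (walkTraj T L (stepInputs U ω) (L - 1)).clock = L - 1}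
    rw [h1, probReal_univ] at h2
    norm_num at hN
    linarith
  -- The rate is `a = 5 * x ^ 2` because `2 ≤ 9 / 20 * 5`; then `L ≤ n` gives `a * (n + L) ≤ 10 * x
  -- ^ 2 * n`.
  have hratio : ∀ x : ℝ, 2 * (x * n / Fintype.card (Fin n)) ^ 2 ≤ 9 / 20 * (5 * x ^ 2) :=
    fun x => by
      rw [Fintype.card_fin, mul_div_cancel_right₀ _ hnR.ne']
      nlinarith [sq_nonneg x]
  have hsize : ∀ x : ℝ, 5 * x ^ 2 * (n + L) ≤ 10 * x ^ 2 * n := fun x => by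
    nlinarith [sq_nonneg x]
  obtain ⟨m, hm, β, hβ, hp⟩ := hlayer (levelTail T L τ n)
    (levelTail_eq_zero τ (by push_cast; linarith) (by norm_num)).le
    (fun i x b β' hx hx1 hβ' => levelTail_succ_le_add_exp τ hL hk0 hG (by positivity) hx1 i hN'
      (hratio x) (by linarith [hsize x]))
    (fun i x D hx hx1 hD => levelTail_succ_le_add_inv τ hL hk0 hG (by positivity) hx1 hD i hN'
      (hratio x) (by
        rw [mul_assoc D]
        exact mul_le_mul_of_nonneg_left (hsize x) hD.le))
  have h1 : 1 - ε ≤ P.real {ω |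
      ¬ β < ((levelSet τ (walkTraj T L (stepInputs U ω)) m n).card : ℝ)} := by
    rw [hU.real_eq_seqExpect (n + L)
      (fun η => ¬ β < ((levelSet τ (walkTraj T L η) m n).card : ℝ)) fun η η' h h' => by
        rwa [← levelSet_congr τ m fun s hs => hcongr (n + L) s η η' h (by omega)]]
    have h2 : levelTail T L τ n m β + seqExpect (n + L) (fun η : ℕ → StepInput G k =>
        if ¬ β < ((levelSet τ (walkTraj T L η) m n).card : ℝ) then (1 : ℝ) else 0) = 1 := by
      rw [levelTail, ← seqExpect_add]
      refine Eq.trans ?_ (seqExpect_const (B := StepInput G k) (n + L) 1)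
      refine congrArg _ (funext fun η => ?_)
      split_ifs <;> simp
    linarith
  refine h1.trans (measureReal_mono fun ω hω => ?_)
  simp only [Set.mem_ofPred_eq, not_lt] at hω ⊢
  rw [htraj]
  have h2 : (levelSet τ (walkTraj T L (stepInputs U ω)) m n).card = 0 := by
    have : ((levelSet τ (walkTraj T L (stepInputs U ω)) m n).card : ℝ) < 1 := by linarith
    exact Nat.lt_one_iff.1 (by exact_mod_cast this)
  have h3 : maxLoad τ (walkTraj T L (stepInputs U ω)) n ≤ m := by
    refine Finset.sup_le fun v _ => ?_
    by_contra hv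
    have : v ∈ levelSet τ (walkTraj T L (stepInputs U ω)) m n :=
      Finset.mem_filter.2 ⟨Finset.mem_univ _, (not_le.1 hv).le⟩
    rw [Finset.card_eq_zero.1 h2] at this
    exact absurd this (Finset.notMem_empty _)
  have h4 : (maxLoad τ (walkTraj T L (stepInputs U ω)) n : ℝ) ≤ m := by exact_mod_cast h3
  linarith
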